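/- Let $X_1,X_2,\dots$ be iid real random variables with distribution function $F$, let $X_{1,n}\le\dots\le X_{n,n}$ be the order statistics of $X_1,\dots,X_n$, and let $Q(\tau)=\inf\{x:F(x)\ge\tau\}$. **Second-order von Mises condition.** Let $\gamma>-1/2$, $\rho\le 0$, and let $a(\cdot)$ be a scaling function that is positive near infinity. Assume that $F$ is twice differentiable on a left neighbourhood of its right end-point, that $Q'(1-1/t)\neq 0$ for all large $t$, and that the function $$A(t)=\frac{Q''(1-1/t)/t-2Q'(1-1/t)}{Q'(1-1/t)}+1-\gamma$$ satisfies: $A(t)\to0$ as $t\to\infty$; $|A|$ is regularly varying at infinity with index $\rho$; and for every $x>0$ $$\lim_{u\downarrow0}\frac1{A(1/u)}\left(\frac{Q(1-ux)-Q(1-u)}{a(1/u)}-\frac{x^{-\gamma}-1}{\gamma}\right)=\int_1^{1/x}v^{\gamma-1}\int_1^v r^{\rho-1}\,dr\,dv .$$ Here and below, expressions with $\gamma$ in a denominator are read by continuity at $\gamma=0$. **Levels.** Let $k=k_n$ be positive integers with $k\to\infty$ and $k/n\to0$, let $0<\nu_n\le k$, and put $\tau_I=1-k/n$, $\tau_E=1-\nu_n/n$,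 $t_E=Q(\tau_E)$ and $\tau^\star=(1-\tau_E)/(1-\tau_I)\in(0,1]$. Assume that $\tau^\star\to\tau_0\in[0,1]$ and, if $\rho=\tau_0=0$, that $|A|$ is nonincreasing near infinity. Let $w_\gamma(x)=\log x$ if $\gamma>0$, $w_0(x)=\log^2x$, and $w_\gamma(x)=x^{-\gamma}$ if $\gamma<0$. Assume that $A(n/k)\,w_\gamma(1/\tau^\star)\to0$. **Densities.** Let $f^\star_{t_E}$ be the density of $X_{n+1}$ given $X_{n+1}>t_E$ and $X_1,\dots,X_n$. For $\theta=(\gamma,\sigma)$ let $h_\theta(x)=\sigma^{-1}h_\gamma(x/\sigma)$, where $h_\gamma(x)=(1+\gamma x)^{-(1/\gamma+1)}$ for $x>0$ with $1+\gamma x>0$, and $h_\gamma(x)=0$ otherwise. Let $\hat\gamma_n,\hat\sigma_n$ be measurable functions of $(X_{n-k,n},\dots,X_{n,n})$, let $\hat\theta_n=(\hat\gamma_n,\hat\sigma_n)$, and define the plug-in predictive density $$\hat h^{(F)}_{\tau_E}(y)=h_{\hat\theta_n}\!\left((y-X_{n-k,n})\,{\tau^\star}^{\hat\gamma_n}-\hat\sigma_n\frac{1-{\tau^\star}^{\hat\gamma_n}}{\hat\gamma_n}\right){\tau^\star}^{\hat\gamma_n}.$$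 **Claim.** Assume that $|\hat\gamma_n-\gamma|=O_{\mathbb P}(1/\sqrt k)$, that $|\hat\sigma_n/a(n/k)-1|=O_{\mathbb P}(1/\sqrt k)$, and that $\sqrt k\,|A(n/k)|\to\lambda\in(0,\infty)$. Then for every sequence $\epsilon_n>0$ with $\epsilon_n\to0$, $k\epsilon_n^2\to\infty$ and $\epsilon_n w_\gamma(1/\tau^\star)\to0$, where in the degenerate case $\gamma\ge0$, $\tau_0=1$ (in which $w_\gamma(1/\tau^\star)\to0$) it is also assumed that $1/\sqrt k=O(\epsilon_n w_\gamma(1/\tau^\star))$, we have $$\mathscr H\big(f^\star_{t_E},\hat h^{(F)}_{\tau_E}\big)=O_{\mathbb P}\!\left(\sqrt{\epsilon_n\,w_\gamma(1/\tau^\star)}\right),\qquad n\to\infty,$$ where $\mathscr H(f,g)=\big(\int(\sqrt f-\sqrt g)^2\,dy\big)^{1/2}$ is the Hellinger distance. -/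

import Mathlib

open Filter Topology MeasureTheory ProbabilityTheory Asymptotics

noncomputable section

namespace ExtremePred

/-! ### Distribution functions, quantiles, predictive distributions of peaks -/

/-- The left-continuous inverse `F^←(τ) = inf {x : F x ≥ τ}` (used only for `0 < τ < 1`). -/
def quantile (F : ℝ → ℝ) (τ : ℝ) : ℝ := sInf {x : ℝ | τ ≤ F x}

/-- Distribution function of a peak above `t`: `y ↦ P(X ≤ y | X > t)` for `X` of law `μ`.
Since the observations are independent, this is also the distribution function of a new
observation given that it exceeds `t` and given the past sample. -/
def predictiveCdf (μ : Measure ℝ) (t y : ℝ) : ℝ := (μ[|Set.Ioi t]).real (Set.Iic y)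

/-- Density of a peak above `t`. -/
def predictiveDensity (μ : Measure ℝ) (t y : ℝ) : ℝ := deriv (predictiveCdf μ t) y

/-! ### The second-order von Mises condition -/

/-- `𝒬_γ(x) = (x ^ (-γ) - 1) / γ`, read as `-log x` when `γ = 0`. -/
def gpQuantile (γ x : ℝ) : ℝ := if γ = 0 then -Real.log x else (x ^ (-γ) - 1) / γ

/-- Regular variation at infinity with index `ρ` of an (eventually positive) function. -/
def IsRegularlyVarying (f : ℝ → ℝ) (ρ : ℝ) : Prop :=
  Measurable f ∧ (∀ᶠ t in atTop, 0 < f t) ∧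
    ∀ x : ℝ, 0 < x → Tendsto (fun t => f (t * x) / f t) atTop (𝓝 (x ^ ρ))

/-- The second-order condition for the quantile function `Q`, with scaling function `a`,
rate function `A`, tail index `γ` and second-order parameter `ρ`. -/
def SecondOrder (Q a A : ℝ → ℝ) (γ ρ : ℝ) : Prop :=
  ρ ≤ 0 ∧ Tendsto A atTop (𝓝 0) ∧ IsRegularlyVarying (fun t => |A t|) ρ ∧
    ∀ x : ℝ, 0 < x →
      Tendsto
        (fun u : ℝ =>
          1 / A (1 / u) * ((Q (1 - u * x) - Q (1 - u)) / a (1 / u) - gpQuantile γ x))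
        (𝓝[>] 0)
        (𝓝 (∫ v in (1 : ℝ)..(1 / x), v ^ (γ - 1) * ∫ r in (1 : ℝ)..v, r ^ (ρ - 1)))

/-- The von Mises rate function
`A(t) = (Q''(1 - 1/t) / t - 2 Q'(1 - 1/t)) / Q'(1 - 1/t) + 1 - γ`. -/
def vonMisesRate (Q : ℝ → ℝ) (γ t : ℝ) : ℝ :=
  (deriv (deriv Q) (1 - 1 / t) / t - 2 * deriv Q (1 - 1 / t)) / deriv Q (1 - 1 / t) + 1 - γ

/-- `F` is twice differentiable on a left neighbourhood of its right end-point, its von Mises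
rate function is well defined near infinity, and the second-order condition holds with it. -/
def VonMisesCondition (F a : ℝ → ℝ) (γ ρ : ℝ) : Prop :=
  (∃ x₀ : ℝ, F x₀ < 1 ∧ ∀ x : ℝ, x₀ < x → F x < 1 →
    DifferentiableAt ℝ F x ∧ DifferentiableAt ℝ (deriv F) x) ∧
  (∀ᶠ t in atTop, deriv (quantile F) (1 - 1 / t) ≠ 0) ∧
  SecondOrder (quantile F) a (vonMisesRate (quantile F) γ) γ ρ

/-! ### Generalized Pareto densities -/

/-- Standard generalized Pareto density `h_γ`. Its support is `(0, ∞)` if `γ ≥ 0` and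
`(0, -1/γ)` if `γ < 0`, that is `{x > 0 : 1 + γ x > 0}` in both cases; at `γ = 0` it is
the exponential density. -/
def gpDensity (γ x : ℝ) : ℝ :=
  if 0 < x ∧ 0 < 1 + γ * x then
    (if γ = 0 then Real.exp (-x) else (1 + γ * x) ^ (-(1 / γ + 1)))
  else 0

/-- `h_θ(x) = h_γ(x / σ) / σ`, where `θ = (γ, σ)`. -/
def gpDensityScaled (γ σ x : ℝ) : ℝ := gpDensity γ (x / σ) / σ

/-- The generalized Pareto approximation of the density of peaks above the extreme threshold,
built from an intermediate threshold `t` and the ratio `τ` of exceedance probabilities: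
`y ↦ h_θ((y - t) τ ^ γ - σ (1 - τ ^ γ) / γ) τ ^ γ`, with `(1 - τ ^ γ) / γ` read as `-log τ`
when `γ = 0`. -/
def gpPredictiveDensity (γ σ τ t y : ℝ) : ℝ :=
  gpDensityScaled γ σ
    ((y - t) * τ ^ γ - σ * (if γ = 0 then -Real.log τ else (1 - τ ^ γ) / γ)) * τ ^ γ

/-- The rate inflation `w_γ`. -/
def w (γ x : ℝ) : ℝ :=
  if 0 < γ then Real.log x else if γ = 0 then Real.log x ^ 2 else x ^ (-γ)

/-- Hellinger distance between two densities on the line. -/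
def hellinger (f g : ℝ → ℝ) : ℝ :=
  Real.sqrt (∫ y, (Real.sqrt (f y) - Real.sqrt (g y)) ^ 2)

/-! ### Samples and stochastic orders -/

/-- The `j`-th order statistic `x_{j,n}` (`1 ≤ j ≤ n`, increasing in `j`) of the sample
`x 0, …, x (n - 1)`. -/
def orderStat (n : ℕ) (x : ℕ → ℝ) (j : ℕ) : ℝ :=
  if h : 1 ≤ j ∧ j ≤ n then
    x (Tuple.sort (fun i : Fin n => x i) ⟨j - 1, by omega⟩)
  else 0

/-- The vector `(x_{n-k,n}, …, x_{n,n})` of the `k + 1` largest order statistics. -/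
def topOrderStats (n k : ℕ) (x : ℕ → ℝ) : Fin (k + 1) → ℝ :=
  fun i => orderStat n x (n - k + i)

/-- `Y_n = O_P(r_n)` as `n → ∞`. -/
def IsBigOP {Ω : Type*} [MeasurableSpace Ω] (P : Measure Ω) (Y : ℕ → Ω → ℝ) (r : ℕ → ℝ) :
    Prop :=
  ∀ δ : ℝ, 0 < δ → ∃ M : ℝ, 0 < M ∧
    ∀ᶠ n in atTop, P {ω | M * r n < |Y n ω|} ≤ ENNReal.ofReal δ

end ExtremePred

end

/-! Put `U x = Q (1 - 1/x)`, `t = n/k`, `s = 1/τ⋆`. A peak above `t_E` has the law of `U (t * V)`,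
where `V` is Pareto on `(s, ∞)`. The plug-in density is that of `T + σ * boxCox b V` for the same
`V`, with `T` the intermediate order statistic and `b`, `σ > 0` the estimates. So two smooth
increasing images of one Pareto variable have to be compared (`IsParetoImage`).

The von Mises condition gives `x ^ (1 - γ) * U' x = exp (L x)` with `L' x = A x / x`
(`TailRepresentation`). In units of `a₀ = t ^ γ * exp (L t)`, the discrepancy between the two images
comes from `|A (t x)|`, `|b - γ|`, `|σ/a₀ - 1|` and `|T - U t|/a₀`. All are `O_P(1/√k)`, up to a
factor `x ^ δ` for the first: the estimators by assumption, once `a` is replaced by `a₀`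
(`exists_abs_div_sub_one_le`); `T` by Chebyshev (`isBigOP_orderStat_sub`); `A` by the balance
condition and a growth bound (`exists_le_mul_rpow`, or monotonicity).

Carried from the intermediate level to `v ≥ s`, these errors are amplified at most by a constant
times `(1 + w_γ s) * (v/s) ^ (3/4)` (`WeightBound`). The factor `w_γ` is the growth of `v ^ (-b) *
∫₁^v (1 + log x) x ^ (b-1) dx`. The exponent `3/4` leaves room for `v ^ (-b)` because `γ > -1/2`,
and being below `1` it is integrable against the Pareto density. Hence the `L¹` distance, which
dominates the squared Hellinger distance, is at most a constant times `(1 + w_γ s)/√k`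
(`hellinger_predictiveDensity_le`). Finally `1/√k ≤ ε` eventually, and `w_γ s` is bounded below
outside the degenerate case, so this is `O(ε * w_γ s)` (`exists_mul_one_add_w_le`). -/

namespace ExtremePred

/-! ### The Box-Cox transform and generalized Pareto densities -/

/-- The Box-Cox transform `(v ^ b - 1) / b`, read as `log v` when `b = 0`. -/
noncomputable def boxCox (b v : ℝ) : ℝ := if b = 0 then Real.log v else (v ^ b - 1) / b

theorem boxCox_one (b : ℝ) : boxCox b 1 = 0 := by
  unfold boxCox; split_ifs <;> simp

theorem hasDerivAt_boxCox (b : ℝ) {v : ℝ} (hv : 0 < v) :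
    HasDerivAt (boxCox b) (v ^ (b - 1)) v := by
  by_cases hb : b = 0
  · have h1 : boxCox b = Real.log := by funext x; simp [boxCox, hb]
    rw [h1, hb, zero_sub, Real.rpow_neg_one]
    exact Real.hasDerivAt_log hv.ne'
  · have h1 : boxCox b = fun x => (x ^ b - 1) / b := by funext x; simp [boxCox, hb]
    rw [h1]
    have h2 := ((Real.hasDerivAt_rpow_const (x := v) (p := b) (Or.inl hv.ne')).sub_const 1).div_const b
    rwa [mul_div_cancel_left₀ _ hb] at h2

theorem abs_log_one_add_le {y : ℝ} (hy : |y| ≤ 1 / 2) : |Real.log (1 + y)| ≤ 2 * |y| := by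
  have hy' := abs_le.1 hy
  have hpos : 0 < 1 + y := by linarith
  rw [abs_le]
  constructor
  · have h := Real.one_sub_inv_le_log_of_pos hpos
    have h2 : 1 - (1 + y)⁻¹ = y / (1 + y) := by field_simp; ring
    rw [h2] at h
    refine le_trans ?_ h
    rw [le_div_iff₀ hpos]
    rcases abs_cases y with ⟨h3, h4⟩ | ⟨h3, h4⟩ <;> rw [h3] <;> nlinarith
  · have h := Real.log_le_sub_one_of_pos hpos
    have := le_abs_self y
    have := abs_nonneg y
    linarith

/-- A perturbation of size `v ^ b * z` of `boxCox b v` is a relative perturbation of size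
`O(z)` of `v`. -/
theorem exists_boxCox_eq_add {b v z : ℝ} (hv : 0 < v) (hz : |b * z| ≤ 1 / 2) :
    ∃ r : ℝ, 0 < r ∧ boxCox b r = boxCox b v + v ^ b * z ∧ |Real.log (r / v)| ≤ 2 * |z| := by
  by_cases hb : b = 0
  · refine ⟨v * Real.exp z, by positivity, ?_, ?_⟩
    · simp only [boxCox, hb, if_true, Real.rpow_zero, one_mul]
      rw [Real.log_mul hv.ne' (Real.exp_pos z).ne', Real.log_exp]
    · rw [mul_div_cancel_left₀ _ hv.ne', Real.log_exp]
      have := abs_nonneg z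
      linarith
  · have hz' := abs_le.1 hz
    have hpos : 0 < 1 + b * z := by linarith
    -- The equation for `r` reads `r ^ b = v ^ b * (1 + b * z)`.
    refine ⟨v * (1 + b * z) ^ (1 / b), by positivity, ?_, ?_⟩
    · simp only [boxCox, hb, if_false]
      rw [Real.mul_rpow hv.le (by positivity), ← Real.rpow_mul hpos.le,
        one_div_mul_cancel hb, Real.rpow_one]
      field_simp
      ring
    · rw [mul_div_cancel_left₀ _ hv.ne', Real.log_rpow hpos, abs_mul]
      have h := abs_log_one_add_le hz
      rw [abs_mul] at h
      have hb' : 0 < |b| := abs_pos.2 hb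
      rw [abs_div, abs_one]
      calc 1 / |b| * |Real.log (1 + b * z)| ≤ 1 / |b| * (2 * (|b| * |z|)) := by gcongr
        _ = 2 * |z| := by field_simp

theorem gpDensity_nonneg (γ x : ℝ) : 0 ≤ gpDensity γ x := by
  unfold gpDensity
  split_ifs with h h2
  · positivity
  · exact Real.rpow_nonneg h.2.le _
  · exact le_rfl

theorem gpPredictiveDensity_nonneg {γ σ τ : ℝ} (hσ : 0 < σ) (hτ : 0 < τ) (t y : ℝ) :
    0 ≤ gpPredictiveDensity γ σ τ t y := by
  unfold gpPredictiveDensity gpDensityScaled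
  have := gpDensity_nonneg γ
    (((y - t) * τ ^ γ - σ * (if γ = 0 then -Real.log τ else (1 - τ ^ γ) / γ)) / σ)
  positivity

/-- The affine change of threshold acts on the Pareto scale as multiplication by `τ`. -/
theorem gpPredictiveDensity_argument {b σ τ r T : ℝ} (hσ : 0 < σ) (hτ : 0 < τ) (hr : 0 < r) :
    ((T + σ * boxCox b r - T) * τ ^ b
      - σ * (if b = 0 then -Real.log τ else (1 - τ ^ b) / b)) / σ = boxCox b (r * τ) := by
  unfold boxCox
  split_ifs with hb
  · rw [hb, Real.rpow_zero, Real.log_mul hr.ne' hτ.ne']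
    field_simp
    ring
  · rw [Real.mul_rpow hr.le hτ.le]
    field_simp
    ring

/-- This is the Pareto density `s / r ^ 2` divided by the derivative `σ * r ^ (b - 1)` of `r ↦ T + σ
* boxCox b r`, so the same formula serves all signs of `b`. -/
theorem gpPredictiveDensity_add_boxCox {b σ s r T : ℝ} (hσ : 0 < σ) (hs : 0 < s) (hr : s < r) :
    gpPredictiveDensity b σ (1 / s) T (T + σ * boxCox b r) = s * r ^ (-1 - b) / σ := by
  have hr0 : 0 < r := hs.trans hr
  have hτ : 0 < 1 / s := by positivity
  unfold gpPredictiveDensity gpDensityScaled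
  rw [gpPredictiveDensity_argument hσ hτ hr0]
  have hrs : 1 < r * (1 / s) := by rw [mul_one_div, one_lt_div hs]; exact hr
  have hrs0 : 0 < r * (1 / s) := by positivity
  unfold gpDensity boxCox
  by_cases hb : b = 0
  · subst hb
    simp only [if_true, Real.rpow_zero, zero_mul, add_zero, mul_one, sub_zero]
    rw [if_pos ⟨Real.log_pos hrs, one_pos⟩, Real.exp_neg, Real.exp_log hrs0, Real.rpow_neg_one]
    field_simp
  · simp only [hb, if_false]
    have h1 : 1 + b * (((r * (1 / s)) ^ b - 1) / b) = (r * (1 / s)) ^ b := by field_simp; ring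
    have h2 : 0 < ((r * (1 / s)) ^ b - 1) / b := by
      rcases lt_or_gt_of_ne hb with h | h
      · exact div_pos_of_neg_of_neg (by linarith [Real.rpow_lt_one_of_one_lt_of_neg hrs h]) h
      · exact div_pos (by linarith [Real.one_lt_rpow hrs h]) h
    rw [h1, if_pos ⟨h2, by positivity⟩, ← Real.rpow_mul hrs0.le]
    have h3 : b * -(1 / b + 1) = -1 - b := by field_simp; ring
    rw [h3, Real.mul_rpow hr0.le hτ.le]
    have h4 : (1 / s) ^ (-1 - b) * (1 / s) ^ b = s := by
      rw [← Real.rpow_add hτ, sub_add_cancel, Real.rpow_neg_one]; simp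
    calc r ^ (-1 - b) * (1 / s) ^ (-1 - b) / σ * (1 / s) ^ b
        = ((1 / s) ^ (-1 - b) * (1 / s) ^ b) * r ^ (-1 - b) / σ := by ring
      _ = _ := by rw [h4]

theorem exists_of_gpPredictiveDensity_ne_zero {b σ s T y : ℝ} (hσ : 0 < σ) (hs : 0 < s)
    (h : gpPredictiveDensity b σ (1 / s) T y ≠ 0) : ∃ r, s < r ∧ y = T + σ * boxCox b r := by
  have hτ : 0 < 1 / s := by positivity
  set x := ((y - T) * (1 / s) ^ b
    - σ * (if b = 0 then -Real.log (1 / s) else (1 - (1 / s) ^ b) / b)) / σ with hx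
  have hx2 : 0 < x ∧ 0 < 1 + b * x := by
    by_contra hcon
    apply h
    unfold gpPredictiveDensity gpDensityScaled gpDensity
    rw [← hx, if_neg hcon]
    simp
  obtain ⟨r, hr, hrx⟩ : ∃ r, 1 < r ∧ boxCox b r = x := by
    by_cases hb : b = 0
    · exact ⟨Real.exp x, Real.one_lt_exp_iff.2 hx2.1, by simp [boxCox, hb]⟩
    · refine ⟨(1 + b * x) ^ (1 / b), ?_, ?_⟩
      · rcases lt_or_gt_of_ne hb with h | h
        · exact Real.one_lt_rpow_of_pos_of_lt_one_of_neg hx2.2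
            (by nlinarith [mul_pos_of_neg_of_neg h (neg_lt_zero.2 hx2.1)])
            (one_div_neg.2 h)
        · exact Real.one_lt_rpow (by nlinarith [mul_pos h hx2.1]) (by positivity)
      · simp only [boxCox, hb, if_false]
        rw [← Real.rpow_mul hx2.2.le, one_div_mul_cancel hb, Real.rpow_one]
        field_simp
        ring
  have hr0 : 0 < r := by linarith
  refine ⟨s * r, by nlinarith, ?_⟩
  have h1 := gpPredictiveDensity_argument (b := b) (T := T) hσ hτ (mul_pos hs hr0)
  have h2 : s * r * (1 / s) = r := by field_simp
  rw [h2, hrx, hx] at h1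
  have hp : 0 < (1 / s) ^ b := by positivity
  field_simp at h1
  have h3 : (T + σ * boxCox b (s * r) - T) * (1 / s) ^ b = (y - T) * (1 / s) ^ b := by linarith
  have h4 := mul_right_cancel₀ hp.ne' h3
  linarith

/-! ### Densities of smooth increasing images of Pareto variables -/

/-- `f` is the density of `q V`, where `V` has the Pareto density `s / v ^ 2` on `(s, ∞)` and `q`
is increasing with derivative `q'`. -/
structure IsParetoImage (s : ℝ) (f q q' : ℝ → ℝ) : Prop where
  hasDerivAt : ∀ v, s < v → HasDerivAt q (q' v) v
  deriv_pos : ∀ v, s < v → 0 < q' v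
  mul_deriv : ∀ v, s < v → f (q v) * q' v = s * v ^ (-2 : ℝ)
  nonneg : ∀ y, 0 ≤ f y
  ae_eq_zero : ∀ᵐ y, y ∉ q '' Set.Ioi s → f y = 0

theorem integrableOn_mul_rpow {s c : ℝ} (hs : 0 < s) {p : ℝ} (hp : p < -1) :
    IntegrableOn (fun v : ℝ => c * v ^ p) (Set.Ioi s) :=
  (integrableOn_Ioi_rpow_of_lt hp hs).const_mul c

theorem integral_pareto {s : ℝ} (hs : 0 < s) :
    ∫ v in Set.Ioi s, s * v ^ (-2 : ℝ) = 1 := by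
  rw [integral_const_mul, integral_Ioi_rpow_of_lt (by norm_num) hs]
  have : (-2 : ℝ) + 1 = -1 := by norm_num
  rw [this, Real.rpow_neg_one]
  field_simp

namespace IsParetoImage

variable {s : ℝ} {f q q' : ℝ → ℝ}

theorem injOn (h : IsParetoImage s f q q') : Set.InjOn q (Set.Ioi s) := by
  apply StrictMonoOn.injOn
  apply strictMonoOn_of_deriv_pos (convex_Ioi s)
  · exact fun v hv => (h.hasDerivAt v hv).continuousAt.continuousWithinAt
  · intro v hv
    rw [interior_Ioi] at hv
    rw [(h.hasDerivAt v hv).deriv]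
    exact h.deriv_pos v hv

theorem integral_image (h : IsParetoImage s f q q') (g : ℝ → ℝ) :
    ∫ y in q '' Set.Ioi s, g y = ∫ v in Set.Ioi s, q' v * g (q v) := by
  rw [integral_image_eq_integral_abs_deriv_smul measurableSet_Ioi
    (fun v hv => (h.hasDerivAt v hv).hasDerivWithinAt) h.injOn]
  refine setIntegral_congr_fun measurableSet_Ioi fun v hv => ?_
  simp only [smul_eq_mul]
  rw [abs_of_pos (h.deriv_pos v hv)]

theorem integrable (h : IsParetoImage s f q q') (hs : 0 < s) : Integrable f := by
  have h1 : IntegrableOn f (q '' Set.Ioi s) := by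
    rw [integrableOn_image_iff_integrableOn_abs_deriv_smul measurableSet_Ioi
      (fun v hv => (h.hasDerivAt v hv).hasDerivWithinAt) h.injOn]
    refine IntegrableOn.congr_fun (integrableOn_mul_rpow (c := s) (p := -2) hs (by norm_num))
      (fun v hv => ?_) measurableSet_Ioi
    simp only [smul_eq_mul]
    rw [abs_of_pos (h.deriv_pos v hv), ← h.mul_deriv v hv, mul_comm]
  exact IntegrableOn.integrable_of_ae_notMem_eq_zero h1 h.ae_eq_zero

theorem integral_eq_one (h : IsParetoImage s f q q') (hs : 0 < s) : ∫ y, f y = 1 := by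
  rw [← setIntegral_eq_integral_of_ae_compl_eq_zero h.ae_eq_zero, h.integral_image,
    ← integral_pareto hs]
  refine setIntegral_congr_fun measurableSet_Ioi fun v hv => ?_
  rw [← h.mul_deriv v hv, mul_comm]

/-- The squared Hellinger distance is at most the `L¹` distance, which for probability densities is
twice the integral of the positive part of the difference. -/
theorem hellinger_le {g p p' : ℝ → ℝ} (hf : IsParetoImage s f q q') (hg : IsParetoImage s g p p')
    (hs : 0 < s) :
    hellinger f g ≤
      Real.sqrt (2 * ∫ v in Set.Ioi s, max (s * v ^ (-2 : ℝ) - g (q v) * q' v) 0) := by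
  unfold hellinger
  apply Real.sqrt_le_sqrt
  have hfi := hf.integrable hs
  have hgi := hg.integrable hs
  have hmax : Integrable fun y => max (f y - g y) 0 := (hfi.sub hgi).pos_part
  have hdiff : Integrable fun y => g y - f y := hgi.sub hfi
  have h1 : ∫ y, max (f y - g y) 0
      = ∫ v in Set.Ioi s, max (s * v ^ (-2 : ℝ) - g (q v) * q' v) 0 := by
    rw [← setIntegral_eq_integral_of_ae_compl_eq_zero (s := q '' Set.Ioi s), hf.integral_image]
    · refine setIntegral_congr_fun measurableSet_Ioi fun v hv => ?_
      rw [← hf.mul_deriv v hv, mul_max_of_nonneg _ _ (hf.deriv_pos v hv).le]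
      congr 1 <;> ring
    · filter_upwards [hf.ae_eq_zero] with y hy hy2
      rw [hy hy2]
      exact max_eq_right (by linarith [hg.nonneg y])
  -- The integrand is `|f - g|`, and `g - f` integrates to zero. Only the positive part of `f - g`
  -- remains, so only lower bounds on `g` are needed, and only on the image of `q`.
  have h2 : ∫ y, (2 * max (f y - g y) 0 + (g y - f y)) = 2 * ∫ y, max (f y - g y) 0 := by
    rw [integral_add (hmax.const_mul 2) hdiff, integral_sub hgi hfi,
      hf.integral_eq_one hs, hg.integral_eq_one hs, integral_const_mul]
    ring
  rw [← h1, ← h2]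
  apply integral_mono_of_nonneg
  · exact Eventually.of_forall fun y => sq_nonneg _
  · exact (hmax.const_mul 2).add hdiff
  · refine Eventually.of_forall fun y => ?_
    simp only
    have ha := Real.sqrt_nonneg (f y)
    have hb := Real.sqrt_nonneg (g y)
    have ha2 := Real.sq_sqrt (hf.nonneg y)
    have hb2 := Real.sq_sqrt (hg.nonneg y)
    rcases le_total (f y) (g y) with h | h
    · rw [max_eq_right (by linarith)]
      nlinarith [Real.sqrt_le_sqrt h]
    · rw [max_eq_left (by linarith)]
      nlinarith [Real.sqrt_le_sqrt h]

end IsParetoImage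

theorem isParetoImage_gpPredictiveDensity {b σ s T : ℝ} (hσ : 0 < σ) (hs : 0 < s) :
    IsParetoImage s (gpPredictiveDensity b σ (1 / s) T) (fun v => T + σ * boxCox b v)
      (fun v => σ * v ^ (b - 1)) where
  hasDerivAt v hv := ((hasDerivAt_boxCox b (hs.trans hv)).const_mul σ).const_add T
  deriv_pos v hv := mul_pos hσ (Real.rpow_pos_of_pos (hs.trans hv) _)
  mul_deriv v hv := by
    have hv0 := hs.trans hv
    rw [gpPredictiveDensity_add_boxCox hσ hs hv]
    have : v ^ (-2 : ℝ) = v ^ (-1 - b) * v ^ (b - 1) := by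
      rw [← Real.rpow_add hv0]; congr 1; ring
    rw [this]
    field_simp
  nonneg y := gpPredictiveDensity_nonneg hσ (by positivity) T y
  ae_eq_zero := Eventually.of_forall fun y hy => by
    by_contra hne
    obtain ⟨r, hr, hy2⟩ := exists_of_gpPredictiveDensity_ne_zero hσ hs hne
    exact hy ⟨r, hr, hy2.symm⟩

/-- The point `G` is `T + σ * boxCox b r` for some `r` with `|log (r/v)| ≤ 2x`, by
`exists_boxCox_eq_add`. The explicit density at `r` then differs from the one at `v` by the factor
`(r/v) ^ (-1-b) ≥ 1 - 4Γx`, and `E` costs another `x`. The hypothesis `s < v * (1 - 2x)` keeps `r`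
inside the support. -/
theorem gpPredictiveDensity_lower_bound {b σ s T G E v x Γ : ℝ} (hσ : 0 < σ) (hs : 0 < s)
    (hv : s < v) (hΓ : 1 ≤ Γ) (hb : |b| ≤ Γ) (hx : Γ * x ≤ 1 / 16)
    (hvs : s < v * (1 - 2 * x)) (hE : |E - 1| ≤ x)
    (hz : |v ^ (-b) * ((G - T) / σ - boxCox b v)| ≤ x) :
    s * v ^ (-2 : ℝ) * (1 - 5 * Γ * x)
      ≤ gpPredictiveDensity b σ (1 / s) T G * (σ * v ^ (b - 1) * E) := by
  have hv0 := hs.trans hv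
  have hx0 : 0 ≤ x := (abs_nonneg _).trans hE
  set z := v ^ (-b) * ((G - T) / σ - boxCox b v) with hzdef
  have hbz : |b * z| ≤ 1 / 2 := by
    rw [abs_mul]
    calc |b| * |z| ≤ Γ * x := mul_le_mul hb hz (abs_nonneg _) (by linarith)
      _ ≤ 1 / 2 := by linarith
  obtain ⟨r, hr0, hr, hlog⟩ := exists_boxCox_eq_add hv0 hbz
  have hG : G = T + σ * boxCox b r := by
    rw [hr, hzdef, ← mul_assoc, ← Real.rpow_add hv0, add_neg_cancel, Real.rpow_zero]
    field_simp
    ring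
  have hlog2 : |Real.log (r / v)| ≤ 2 * x := by linarith
  have hrv : v * (1 - 2 * x) ≤ r := by
    have h1 : 1 - 2 * x ≤ r / v := by
      calc 1 - 2 * x ≤ Real.log (r / v) + 1 := by linarith [(abs_le.1 hlog2).1]
        _ ≤ Real.exp (Real.log (r / v)) := Real.add_one_le_exp _
        _ = r / v := Real.exp_log (by positivity)
    rw [le_div_iff₀ hv0] at h1
    linarith
  rw [hG, gpPredictiveDensity_add_boxCox hσ hs (hvs.trans_le hrv)]
  have h2 : (r / v) ^ (-1 - b) = r ^ (-1 - b) * (v ^ (2 : ℝ) * v ^ (b - 1)) := by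
    rw [Real.div_rpow hr0.le hv0.le, ← Real.rpow_add hv0, div_eq_mul_inv, ← Real.rpow_neg hv0.le]
    congr 2; ring
  have h3 : 1 - 4 * Γ * x ≤ (r / v) ^ (-1 - b) := by
    rw [Real.rpow_def_of_pos (by positivity)]
    refine le_trans ?_ (Real.add_one_le_exp _)
    have h4 : |Real.log (r / v) * (-1 - b)| ≤ 2 * x * (2 * Γ) := by
      rw [abs_mul]
      gcongr
      have := abs_le.1 hb
      rw [abs_le]; constructor <;> linarith
    linarith [(abs_le.1 h4).1]
  have hE' := (abs_le.1 hE).1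
  have h5 : s * r ^ (-1 - b) / σ * (σ * v ^ (b - 1) * E)
      = s * v ^ (-2 : ℝ) * ((r / v) ^ (-1 - b) * E) := by
    rw [h2, Real.rpow_neg hv0.le]
    have : 0 < v ^ (2 : ℝ) := by positivity
    field_simp
  rw [h5]
  have hΓx : x ≤ Γ * x := le_mul_of_one_le_left hx0 hΓ
  have h6 : 1 - 5 * Γ * x ≤ (r / v) ^ (-1 - b) * E := by
    calc 1 - 5 * Γ * x ≤ (1 - 4 * Γ * x) * (1 - x) := by
          nlinarith [mul_nonneg hx0 (hx0.trans hΓx)]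
      _ ≤ (r / v) ^ (-1 - b) * E := by
        apply mul_le_mul h3 (by linarith) (by linarith) (by positivity)
  gcongr

/-- If the quantile function `G` of peaks and its derivative `G'` are relatively close to those
of the generalized Pareto approximation, then so are the densities. -/
theorem hellinger_gpPredictiveDensity_le {b σ s T κ Γ : ℝ} {f G G' : ℝ → ℝ}
    (hf : IsParetoImage s f G G') (hσ : 0 < σ) (hs : 0 < s) (hΓ : 1 ≤ Γ) (hb : |b| ≤ Γ) (hκ : 0 < κ)
    (hE : ∀ v, s < v → κ * (v / s) ^ (3 / 4 : ℝ) ≤ 1 / 16 →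
      |G' v * v ^ (1 - b) / σ - 1| ≤ κ * (v / s) ^ (3 / 4 : ℝ))
    (hz : ∀ v, s < v → κ * (v / s) ^ (3 / 4 : ℝ) ≤ 1 / 16 →
      |v ^ (-b) * ((G v - T) / σ - boxCox b v)| ≤ κ * (v / s) ^ (3 / 4 : ℝ)) :
    hellinger f (gpPredictiveDensity b σ (1 / s) T) ≤ Real.sqrt (200 * Γ * κ) := by
  refine (hf.hellinger_le (isParetoImage_gpPredictiveDensity hσ hs) hs).trans ?_
  apply Real.sqrt_le_sqrt
  -- The first term is `16Γx` times the Pareto density, with `x = κ (v/s) ^ (3/4)`. The second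
  -- covers a boundary layer above `s`, where `G v` may fall below the support of the approximating
  -- density; there the Pareto density is at most `1/s`.
  set B : ℝ → ℝ := fun v => 16 * Γ * κ * s * s ^ (-(3 / 4) : ℝ) * v ^ (-(5 / 4) : ℝ) +
    (Set.Ioc s (s * (1 + 8 * κ))).indicator (fun _ => 1 / s) v with hB
  have hBint1 : IntegrableOn (fun v : ℝ => 16 * Γ * κ * s * s ^ (-(3 / 4) : ℝ) * v ^ (-(5 / 4) : ℝ))
      (Set.Ioi s) := integrableOn_mul_rpow hs (by norm_num)
  have hBint2 : Integrable ((Set.Ioc s (s * (1 + 8 * κ))).indicator (fun _ => 1 / s)) := by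
    rw [integrable_indicator_iff measurableSet_Ioc]
    exact integrableOn_const (by simp)
  have hint : ∫ v in Set.Ioi s, B v ≤ 72 * Γ * κ := by
    rw [hB, integral_add hBint1 hBint2.integrableOn, integral_const_mul,
      integral_Ioi_rpow_of_lt (by norm_num) hs, setIntegral_indicator measurableSet_Ioc,
      Set.inter_eq_right.2 Set.Ioc_subset_Ioi_self, setIntegral_const]
    have h1 : s * s ^ (-(3 / 4) : ℝ) * s ^ (-(5 / 4) + 1 : ℝ) = 1 := by
      nth_rewrite 1 [← Real.rpow_one s]
      rw [← Real.rpow_add hs, ← Real.rpow_add hs]; norm_num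
    have h2 : 16 * Γ * κ * s * s ^ (-(3 / 4) : ℝ) * (-s ^ (-(5 / 4) + 1 : ℝ) / (-(5 / 4) + 1)) =
        64 * Γ * κ * (s * s ^ (-(3 / 4) : ℝ) * s ^ (-(5 / 4) + 1 : ℝ)) := by ring
    rw [h2, h1]
    have h3 : volume.real (Set.Ioc s (s * (1 + 8 * κ))) = 8 * κ * s := by
      rw [Real.volume_real_Ioc_of_le (by nlinarith)]; ring
    rw [h3, smul_eq_mul]
    have h4 : 8 * κ * s * (1 / s) = 8 * κ := by field_simp
    rw [h4]
    nlinarith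
  have hmono : ∫ v in Set.Ioi s, max (s * v ^ (-2 : ℝ)
      - gpPredictiveDensity b σ (1 / s) T (G v) * G' v) 0 ≤ ∫ v in Set.Ioi s, B v := by
    apply integral_mono_of_nonneg
    · exact Eventually.of_forall fun v => le_max_right _ _
    · exact hBint1.add hBint2.integrableOn
    · refine (ae_restrict_iff' measurableSet_Ioi).2 (Eventually.of_forall fun v hv => ?_)
      have hv : s < v := hv
      have hv0 := hs.trans hv
      have hp : 0 ≤ s * v ^ (-2 : ℝ) := by positivity
      set x := κ * (v / s) ^ (3 / 4 : ℝ) with hxdef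
      have hx0 : 0 ≤ x := by positivity
      have hBx : B v = 16 * Γ * x * (s * v ^ (-2 : ℝ)) +
          (Set.Ioc s (s * (1 + 8 * κ))).indicator (fun _ => 1 / s) v := by
        have h1 : v ^ (-(5 / 4) : ℝ) = v ^ (3 / 4 : ℝ) * v ^ (-2 : ℝ) := by
          rw [← Real.rpow_add hv0]; norm_num
        simp only [hB, hxdef]
        rw [Real.div_rpow hv0.le hs.le, h1, Real.rpow_neg hs.le]
        ring
      have hind : 0 ≤ (Set.Ioc s (s * (1 + 8 * κ))).indicator (fun _ => 1 / s) v :=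
        Set.indicator_nonneg (fun _ _ => by positivity) v
      have hgG : 0 ≤ gpPredictiveDensity b σ (1 / s) T (G v) * G' v :=
        mul_nonneg (gpPredictiveDensity_nonneg hσ (by positivity) _ _) (hf.deriv_pos v hv).le
      rw [hBx]
      apply max_le _ (by positivity)
      have hΓx : x ≤ Γ * x := le_mul_of_one_le_left hx0 hΓ
      -- If `Γ * x > 1/16`, the first term of `B` already exceeds the whole Pareto density.
      by_cases hxs : Γ * x ≤ 1 / 16
      · by_cases hvm : v ≤ s * (1 + 8 * κ)
        · rw [Set.indicator_of_mem (show v ∈ Set.Ioc s _ from ⟨hv, hvm⟩)]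
          have h1 : s * v ^ (-2 : ℝ) ≤ 1 / s := by
            have : v ^ (-2 : ℝ) ≤ s ^ (-2 : ℝ) :=
              Real.rpow_le_rpow_of_nonpos hs hv.le (by norm_num)
            calc s * v ^ (-2 : ℝ) ≤ s * s ^ (-2 : ℝ) := by gcongr
              _ = 1 / s := by
                rw [show (-2 : ℝ) = -(2 : ℕ) by norm_num, Real.rpow_neg hs.le, Real.rpow_natCast]
                field_simp
          nlinarith [mul_nonneg (hx0.trans hΓx) hp]
        · have hvm' := not_le.1 hvm
          -- For `v ≤ 2s` one has `x ≤ 2κ`, and `(1 + 8κ)(1 - 4κ) ≥ 1` since `κ ≤ 1/16`. For `v ≥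
          -- 2s`, `x ≤ 1/16` suffices.
          have hvs : s < v * (1 - 2 * x) := by
            rcases le_total v (2 * s) with h2 | h2
            · have h3 : (v / s) ^ (3 / 4 : ℝ) ≤ 2 := by
                have h4 : v / s ≤ 2 := by rw [div_le_iff₀ hs]; exact h2
                have h5 : 1 ≤ v / s := by rw [le_div_iff₀ hs]; linarith
                calc (v / s) ^ (3 / 4 : ℝ) ≤ (v / s) ^ (1 : ℝ) :=
                      Real.rpow_le_rpow_of_exponent_le h5 (by norm_num)
                  _ ≤ 2 := by rw [Real.rpow_one]; exact h4
              have h6 : x ≤ 2 * κ := by rw [hxdef]; nlinarith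
              have h7 : 1 ≤ (v / s) ^ (3 / 4 : ℝ) :=
                Real.one_le_rpow (by rw [le_div_iff₀ hs]; linarith) (by norm_num)
              have h8 : κ ≤ 1 / 16 := by nlinarith
              have h9 : v * (1 - 4 * κ) ≤ v * (1 - 2 * x) := by
                apply mul_le_mul_of_nonneg_left _ hv0.le; linarith
              refine lt_of_lt_of_le ?_ h9
              have h10 : s * (1 + 8 * κ) * (1 - 4 * κ) < v * (1 - 4 * κ) := by
                apply mul_lt_mul_of_pos_right hvm'; linarith
              refine lt_of_le_of_lt ?_ h10
              have h11 : 1 ≤ (1 + 8 * κ) * (1 - 4 * κ) := by nlinarith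
              calc s = s * 1 := (mul_one s).symm
                _ ≤ s * ((1 + 8 * κ) * (1 - 4 * κ)) := by gcongr
                _ = _ := by ring
            · nlinarith
          have hxs' : x ≤ 1 / 16 := hΓx.trans hxs
          have hlow := gpPredictiveDensity_lower_bound (G := G v) hσ hs hv hΓ hb
            hxs hvs (hE v hv hxs') (hz v hv hxs')
          have h12 : σ * v ^ (b - 1) * (G' v * v ^ (1 - b) / σ) = G' v := by
            have : v ^ (b - 1) * v ^ (1 - b) = 1 := by
              rw [← Real.rpow_add hv0]; norm_num
            field_simp
            linear_combination G' v * this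
          rw [h12] at hlow
          nlinarith [mul_nonneg (hx0.trans hΓx) hp]
      · have : 1 ≤ 16 * (Γ * x) := by linarith
        nlinarith [mul_nonneg (hx0.trans hΓx) hp]
  nlinarith [mul_pos (by linarith : 0 < Γ) hκ]

/-! ### Bounds for regularly varying functions -/

theorem IsRegularlyVarying.tendstoInMeasure {f : ℝ → ℝ} {ρ : ℝ} (hf : IsRegularlyVarying f ρ)
    {u : ℕ → ℝ} (hu : Tendsto u atTop atTop) :
    TendstoInMeasure (volume.restrict (Set.Icc (1 : ℝ) 4)) (fun n x => f (u n * x) / f (u n)) atTop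
      (fun x => x ^ ρ) := by
  apply tendstoInMeasure_of_tendsto_ae
  · intro n
    exact ((hf.1.comp (measurable_const_mul (u n))).div_const _).aestronglyMeasurable
  · refine (ae_restrict_iff' measurableSet_Icc).2 (Eventually.of_forall fun x hx => ?_)
    exact (hf.2.2 x (by linarith [hx.1])).comp hu

/-- The tolerance `4 ^ ρ / 2` is half the minimum of `x ^ ρ` on `[1, 4]`, so outside the exceptional
set the ratio is bounded above and away from zero. -/
theorem abs_div_sub_rpow_lt {f : ℝ → ℝ} {ρ x t : ℝ} (hρ : ρ ≤ 0)
    (hx : x ∈ Set.Icc (1 : ℝ) 4) (ht : 0 < f t)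
    (h : x ∉ {x | ENNReal.ofReal ((4 : ℝ) ^ ρ / 2) ≤ edist (f (t * x) / f t) (x ^ ρ)}) :
    4 ^ ρ / 2 * f t ≤ f (t * x) ∧ f (t * x) ≤ 2 * f t := by
  rw [Set.mem_ofPred_eq, not_le, edist_dist, Real.dist_eq,
    ENNReal.ofReal_lt_ofReal_iff (by positivity), abs_lt] at h
  have hx0 : 0 < x := by linarith [hx.1]
  have h1 : (4 : ℝ) ^ ρ ≤ x ^ ρ := Real.rpow_le_rpow_of_nonpos hx0 hx.2 hρ
  have h2 : x ^ ρ ≤ 1 := Real.rpow_le_one_of_one_le_of_nonpos hx.1 hρ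
  constructor
  · rw [← le_div_iff₀ ht]; linarith
  · rw [← div_le_iff₀ ht]; linarith

/-- Local uniformity comes from measurability. Along a violating sequence `t n`, `x n`, the ratios
based at `t n` and at `t n * x n` both converge in measure, so some point `t n * y` is good for both
base points. Comparing `f` there with `f (t n)` and with `f (t n * x n)` bounds `f (t n * x n) / f
(t n)`. -/
theorem IsRegularlyVarying.exists_le_on_Icc {f : ℝ → ℝ} {ρ : ℝ} (hf : IsRegularlyVarying f ρ)
    (hρ : ρ ≤ 0) :
    ∃ C T : ℝ, 0 < C ∧ ∀ t, T ≤ t → ∀ x ∈ Set.Icc (1 : ℝ) 2, f (t * x) ≤ C * f t := by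
  by_contra! hcon
  have hcon' : ∀ n : ℕ, ∃ t : ℝ, (n : ℝ) ≤ t ∧ ∃ x ∈ Set.Icc (1 : ℝ) 2,
      ((n : ℝ) + 1) * f t < f (t * x) := fun n => hcon _ _ (by positivity)
  choose t ht x hx hfx using hcon'
  have htt : Tendsto t atTop atTop := tendsto_atTop_mono ht tendsto_natCast_atTop_atTop
  have hut : Tendsto (fun n => t n * x n) atTop atTop := by
    refine tendsto_atTop_mono (fun n => ?_) htt
    have : 0 ≤ t n := (Nat.cast_nonneg n).trans (ht n)
    nlinarith [(hx n).1]
  set ε : ENNReal := ENNReal.ofReal ((4 : ℝ) ^ ρ / 2) with hε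
  have hε0 : 0 < ε := ENNReal.ofReal_pos.2 (by positivity)
  have h1 := hf.tendstoInMeasure htt ε hε0
  have h2 := hf.tendstoInMeasure hut ε hε0
  have hhalf : (0 : ENNReal) < ENNReal.ofReal (1 / 2) := by simp
  obtain ⟨N, hN⟩ := exists_nat_gt (4 / (4 : ℝ) ^ ρ)
  obtain ⟨n, hn1, hn2, hn3, hn4, hnN⟩ := ((h1.eventually_lt_const hhalf).and
    ((h2.eventually_lt_const hhalf).and ((htt.eventually hf.2.1).and
      ((hut.eventually hf.2.1).and (eventually_ge_atTop N))))).exists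
  rw [Measure.restrict_apply' measurableSet_Icc] at hn1 hn2
  set B1 := {y | ε ≤ edist (f (t n * y) / f (t n)) (y ^ ρ)} ∩ Set.Icc 1 4 with hB1
  set B2 := {y | ε ≤ edist (f (t n * x n * y) / f (t n * x n)) (y ^ ρ)} ∩ Set.Icc 1 4 with hB2
  have hx0 : 0 < x n := by linarith [(hx n).1]
  set B3 := ((x n)⁻¹ * ·) ⁻¹' B2 with hB3
  have hB3v : volume B3 ≤ ENNReal.ofReal 1 := by
    rw [hB3, Real.volume_preimage_mul_left (inv_ne_zero hx0.ne'), inv_inv, abs_of_pos hx0]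
    calc ENNReal.ofReal (x n) * volume B2
        ≤ ENNReal.ofReal 2 * ENNReal.ofReal (1 / 2) := by
          gcongr
          exact (hx n).2
      _ = ENNReal.ofReal 1 := by rw [← ENNReal.ofReal_mul (by norm_num)]; norm_num
  -- The bad sets have total measure at most `1/2 + 1`, the second being dilated by `x n ≤ 2`, while
  -- `[2, 4]` has length `2`. Starting at `2` keeps `y / x n` in `[1, 4]`.
  obtain ⟨y, hy, hyB⟩ : ∃ y ∈ Set.Icc (2 : ℝ) 4, y ∉ B1 ∪ B3 := by
    by_contra! hcov
    have h3 : volume (Set.Icc (2 : ℝ) 4) ≤ volume B1 + volume B3 :=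
      (measure_mono hcov).trans (measure_union_le _ _)
    have h4 : volume B1 + volume B3 ≤ ENNReal.ofReal (3 / 2) := by
      calc volume B1 + volume B3 ≤ ENNReal.ofReal (1 / 2) + ENNReal.ofReal 1 := by
            gcongr
        _ = ENNReal.ofReal (3 / 2) := by
            rw [← ENNReal.ofReal_add (by norm_num) (by norm_num)]; norm_num
    have h5 := h3.trans h4
    rw [Real.volume_Icc, ENNReal.ofReal_le_ofReal_iff (by norm_num)] at h5
    norm_num at h5
  have hy14 : y ∈ Set.Icc (1 : ℝ) 4 := ⟨by linarith [hy.1], hy.2⟩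
  have hyx : (x n)⁻¹ * y ∈ Set.Icc (1 : ℝ) 4 := by
    have hx12 := hx n
    rw [inv_mul_eq_div]
    constructor
    · rw [le_div_iff₀ hx0]; linarith [hx12.2, hy.1]
    · rw [div_le_iff₀ hx0]; linarith [hx12.1, hy.2]
  have hy1 := (abs_div_sub_rpow_lt hρ hy14 hn3 (fun hm => hyB (Or.inl ⟨hm, hy14⟩))).2
  have hy2 := (abs_div_sub_rpow_lt hρ hyx hn4 (fun hm => hyB (Or.inr ⟨hm, hyx⟩))).1
  have h6 : t n * x n * ((x n)⁻¹ * y) = t n * y := by field_simp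
  rw [h6] at hy2
  have h7 := hfx n
  have hp : (0 : ℝ) < 4 ^ ρ := by positivity
  have h8 : 4 ^ ρ / 2 * ((n + 1) * f (t n)) < 2 * f (t n) :=
    (mul_lt_mul_of_pos_left h7 (by positivity)).trans_le (hy2.trans hy1)
  have h9 : (4 : ℝ) ^ ρ * (n + 1) < 4 := by
    by_contra! h10
    nlinarith
  have h10 : (N : ℝ) ≤ n := by exact_mod_cast hnN
  rw [div_lt_iff₀ hp] at hN
  nlinarith

/-- A one-sided Potter bound: iterate `f (2t) ≤ 2 ^ δ * f t` along powers of two and use the local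
bound for the last factor in `[1, 2]`. The case `δ = 0` is included when `ρ < 0`. -/
theorem IsRegularlyVarying.exists_le_mul_rpow {f : ℝ → ℝ} {ρ δ : ℝ}
    (hf : IsRegularlyVarying f ρ) (hρ : ρ ≤ 0) (hδ : 0 ≤ δ) (hρδ : ρ < δ) :
    ∃ C T : ℝ, 0 < C ∧ ∀ t, T ≤ t → ∀ x, 1 ≤ x → f (t * x) ≤ C * x ^ δ * f t := by
  obtain ⟨C, T, hC, hCT⟩ := hf.exists_le_on_Icc hρ
  have h1 : ∀ᶠ t in atTop, f (t * 2) / f t < 2 ^ δ :=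
    (hf.2.2 2 two_pos).eventually_lt_const
      (Real.rpow_lt_rpow_of_exponent_lt (by norm_num) hρδ)
  obtain ⟨T', hT'⟩ := eventually_atTop.1 (h1.and hf.2.1)
  refine ⟨C, max (max T T') 0, hC, fun t ht x hx => ?_⟩
  have ht0 : 0 ≤ t := (le_max_right _ _).trans ht
  have htT : T ≤ t := (le_max_left _ _).trans ((le_max_left _ _).trans ht)
  have htT' : T' ≤ t := (le_max_right _ _).trans ((le_max_left _ _).trans ht)
  have hmono : ∀ m : ℕ, t ≤ t * 2 ^ m := fun m =>
    le_mul_of_one_le_right ht0 (one_le_pow₀ (by norm_num))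
  have hpow : ∀ m : ℕ, f (t * 2 ^ m) ≤ ((2 : ℝ) ^ m) ^ δ * f t := by
    intro m
    induction m with
    | zero => simp
    | succ m ih =>
      obtain ⟨h2, h3⟩ := hT' (t * 2 ^ m) (htT'.trans (hmono m))
      rw [div_lt_iff₀ h3] at h2
      rw [pow_succ, ← mul_assoc]
      calc f (t * 2 ^ m * 2) ≤ 2 ^ δ * f (t * 2 ^ m) := h2.le
        _ ≤ 2 ^ δ * (((2 : ℝ) ^ m) ^ δ * f t) := by gcongr
        _ = ((2 : ℝ) ^ m * 2) ^ δ * f t := by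
          rw [Real.mul_rpow (by positivity) (by norm_num)]; ring
  obtain ⟨m, hm1, hm2⟩ := exists_nat_pow_near hx (one_lt_two : (1 : ℝ) < 2)
  have h2m : (0 : ℝ) < 2 ^ m := by positivity
  have hft : 0 < f t := (hT' t htT').2
  have h4 : x / 2 ^ m ∈ Set.Icc (1 : ℝ) 2 := by
    rw [pow_succ] at hm2
    constructor
    · rw [le_div_iff₀ h2m]; linarith
    · rw [div_le_iff₀ h2m]; linarith
  have h5 := hCT (t * 2 ^ m) (htT.trans (hmono m)) _ h4
  have h6 : t * 2 ^ m * (x / 2 ^ m) = t * x := by field_simp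
  rw [h6] at h5
  calc f (t * x) ≤ C * f (t * 2 ^ m) := h5
    _ ≤ C * (((2 : ℝ) ^ m) ^ δ * f t) := by gcongr; exact hpow m
    _ ≤ C * (x ^ δ * f t) := by gcongr
    _ = C * x ^ δ * f t := by ring

/-! ### Quantile functions -/

section quantile

variable {μ : Measure ℝ}

theorem quantile_le_iff {τ : ℝ} (hτ0 : 0 < τ) (hτ1 : τ < 1) (x : ℝ) :
    quantile (cdf μ) τ ≤ x ↔ τ ≤ cdf μ x := by
  set S := {x : ℝ | τ ≤ cdf μ x} with hS
  have hne : S.Nonempty := by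
    obtain ⟨x, hx⟩ := ((tendsto_cdf_atTop μ).eventually_const_lt hτ1).exists
    exact ⟨x, hx.le⟩
  have hbdd : BddBelow S := by
    obtain ⟨x, hx⟩ := ((tendsto_cdf_atBot μ).eventually_lt_const hτ0).exists
    refine ⟨x, fun y hy => ?_⟩
    by_contra! hyx
    have h1 : τ ≤ cdf μ y := hy
    exact absurd (h1.trans (monotone_cdf μ hyx.le)) (not_le.2 hx)
  have habove : ∀ y, sInf S < y → τ ≤ cdf μ y := fun y hy => by
    obtain ⟨z, hz, hzy⟩ := exists_lt_of_csInf_lt hne hy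
    have h1 : τ ≤ cdf μ z := hz
    exact h1.trans (monotone_cdf μ hzy.le)
  have hmem : τ ≤ cdf μ (sInf S) := by
    have h1 : Tendsto (cdf μ) (𝓝[>] sInf S) (𝓝 (cdf μ (sInf S))) :=
      ((cdf μ).right_continuous (sInf S)).mono_left (nhdsWithin_mono _ Set.Ioi_subset_Ici_self)
    exact ge_of_tendsto h1 (eventually_nhdsWithin_of_forall fun y hy => habove y hy)
  exact ⟨fun h => hmem.trans (monotone_cdf μ h), fun h => csInf_le hbdd h⟩

theorem le_cdf_quantile {τ : ℝ} (hτ0 : 0 < τ) (hτ1 : τ < 1) :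
    τ ≤ cdf μ (quantile (cdf μ) τ) := (quantile_le_iff hτ0 hτ1 _).1 le_rfl

theorem quantile_mono {τ τ' : ℝ} (hτ0 : 0 < τ) (h : τ ≤ τ') (hτ1 : τ' < 1) :
    quantile (cdf μ) τ ≤ quantile (cdf μ) τ' :=
  (quantile_le_iff hτ0 (h.trans_lt hτ1) _).2 (h.trans (le_cdf_quantile (hτ0.trans_le h) hτ1))

/-- Near its right end-point, a distribution function satisfying the von Mises condition and its
quantile function are inverse to each other, with twice differentiable quantile function. -/
theorem VonMisesCondition.exists_quantile {a : ℝ → ℝ} {γ ρ : ℝ}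
    (h : VonMisesCondition (cdf μ) a γ ρ) :
    ∃ τ₁ : ℝ, 0 < τ₁ ∧ τ₁ < 1 ∧
      (∀ τ, τ₁ < τ → τ < 1 → 0 < deriv (quantile (cdf μ)) τ ∧
        DifferentiableAt ℝ (quantile (cdf μ)) τ ∧
        DifferentiableAt ℝ (deriv (quantile (cdf μ))) τ ∧
        cdf μ (quantile (cdf μ) τ) = τ ∧
        HasDerivAt (cdf μ) (deriv (quantile (cdf μ)) τ)⁻¹ (quantile (cdf μ) τ)) ∧
      ∀ y, τ₁ < cdf μ y → cdf μ y < 1 → quantile (cdf μ) (cdf μ y) = y := by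
  obtain ⟨⟨x₀, hx₀, hdiff⟩, hne, -⟩ := h
  set F : ℝ → ℝ := ⇑(cdf μ) with hF
  set Q := quantile F with hQ
  have hFmono : Monotone F := monotone_cdf μ
  obtain ⟨T, hT⟩ := eventually_atTop.1 hne
  -- The `2` forces `τ₁ ≥ 1/2 > 0`, as needed for the Galois connection `quantile_le_iff`.
  set T' := max T 2 with hT'
  have hT'2 : 2 ≤ T' := le_max_right _ _
  have hT'0 : 0 < T' := by linarith
  set τ₁ := max (F x₀) (1 - 1 / T') with hτ₁
  have hτ₁0 : 0 < τ₁ := by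
    refine lt_of_lt_of_le ?_ (le_max_right _ _)
    have : 1 / T' ≤ 1 / 2 := one_div_le_one_div_of_le (by norm_num) hT'2
    linarith
  have hτ₁1 : τ₁ < 1 := max_lt hx₀ (by have : 0 < 1 / T' := by positivity
                                       linarith)
  have hQ' : ∀ τ, τ₁ < τ → τ < 1 → deriv Q τ ≠ 0 := by
    intro τ h1 h2
    have h3 : 1 - 1 / T' < τ := (le_max_right _ _).trans_lt h1
    have h4 : 0 < 1 - τ := by linarith
    have h5 : T' ≤ 1 / (1 - τ) := by
      rw [le_div_iff₀ h4]
      have : 1 - τ ≤ 1 / T' := by linarith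
      calc T' * (1 - τ) ≤ T' * (1 / T') := by gcongr
        _ = 1 := by field_simp
    have h6 := hT _ ((le_max_left _ _).trans h5)
    simpa using h6
  -- `deriv` is `0` at points of non-differentiability, so a nonzero value gives differentiability.
  have hQd : ∀ τ, τ₁ < τ → τ < 1 → DifferentiableAt ℝ Q τ := fun τ h1 h2 =>
    differentiableAt_of_deriv_ne_zero (hQ' τ h1 h2)
  have hQx₀ : ∀ τ, τ₁ < τ → τ < 1 → x₀ < Q τ := by
    intro τ h1 h2
    by_contra! hle
    have h3 := (quantile_le_iff (hτ₁0.trans h1) h2 x₀).1 hle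
    have h4 : F x₀ ≤ τ₁ := le_max_left _ _
    exact absurd (h3.trans h4) (not_le.2 h1)
  have hFQ : ∀ τ, τ₁ < τ → τ < 1 → F (Q τ) = τ := by
    intro τ h1 h2
    have hτ0 := hτ₁0.trans h1
    refine le_antisymm ?_ (le_cdf_quantile hτ0 h2)
    -- An overshoot `F (Q τ) > τ` is either below `1`, contradicting continuity of `F` at `Q τ` and
    -- minimality of `Q τ`, or equal to `1`. In the latter case `Q` is constant on `(τ, 1)`, against
    -- `Q' ≠ 0`.
    by_contra! hlt
    rcases (cdf_le_one μ (Q τ)).lt_or_eq with h3 | h3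
    · have hc : ContinuousAt F (Q τ) := (hdiff _ (hQx₀ τ h1 h2) h3).1.continuousAt
      have h4 : ∀ᶠ x in 𝓝[<] (Q τ), τ < F x :=
        (hc.eventually (lt_mem_nhds hlt)).filter_mono nhdsWithin_le_nhds
      obtain ⟨x, hx, hxlt⟩ := (h4.and self_mem_nhdsWithin).exists
      have h5 := (quantile_le_iff hτ0 h2 x).2 hx.le
      exact absurd h5 (not_le.2 hxlt)
    · have h5 : τ < (τ + 1) / 2 := by linarith
      have h6 : (τ + 1) / 2 < 1 := by linarith
      apply hQ' ((τ + 1) / 2) (h1.trans h5) h6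
      have h7 : Q =ᶠ[𝓝 ((τ + 1) / 2)] fun _ => Q τ := by
        filter_upwards [Ioo_mem_nhds h5 h6] with τ' hτ'
        refine le_antisymm ?_ (quantile_mono hτ0 hτ'.1.le hτ'.2)
        exact (quantile_le_iff (hτ0.trans hτ'.1) hτ'.2 _).2 (by rw [h3]; exact hτ'.2.le)
      rw [h7.deriv_eq]
      exact deriv_const _ _
  have hchain : ∀ τ, τ₁ < τ → τ < 1 → deriv F (Q τ) * deriv Q τ = 1 := by
    intro τ h1 h2
    have hd : HasDerivAt F (deriv F (Q τ)) (Q τ) :=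
      (hdiff _ (hQx₀ τ h1 h2) (by rw [hFQ τ h1 h2]; exact h2)).1.hasDerivAt
    have hcomp := hd.comp τ (hQd τ h1 h2).hasDerivAt
    have hid : (F ∘ Q) =ᶠ[𝓝 τ] id := by
      filter_upwards [Ioo_mem_nhds h1 h2] with τ' hτ'
      exact hFQ τ' hτ'.1 hτ'.2
    exact (hcomp.congr_of_eventuallyEq hid.symm).unique (hasDerivAt_id τ)
  have hFd : ∀ τ, τ₁ < τ → τ < 1 → HasDerivAt F (deriv Q τ)⁻¹ (Q τ) := by
    intro τ h1 h2
    rw [← eq_inv_of_mul_eq_one_left (hchain τ h1 h2)]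
    exact (hdiff _ (hQx₀ τ h1 h2) (by rw [hFQ τ h1 h2]; exact h2)).1.hasDerivAt
  refine ⟨τ₁, hτ₁0, hτ₁1, fun τ h1 h2 => ⟨?_, hQd τ h1 h2, ?_, hFQ τ h1 h2, hFd τ h1 h2⟩, ?_⟩
  · have h3 := hchain τ h1 h2
    have h4 : 0 ≤ deriv F (Q τ) := hFmono.deriv_nonneg
    by_contra! hle
    nlinarith
  · have heq : deriv Q =ᶠ[𝓝 τ] fun τ' => (deriv F (Q τ'))⁻¹ := by
      filter_upwards [Ioo_mem_nhds h1 h2] with τ' hτ'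
      exact eq_inv_of_mul_eq_one_right (hchain τ' hτ'.1 hτ'.2)
    refine DifferentiableAt.congr_of_eventuallyEq ?_ heq
    refine DifferentiableAt.inv ?_ (left_ne_zero_of_mul_eq_one (hchain τ h1 h2))
    exact (hdiff _ (hQx₀ τ h1 h2) (by rw [hFQ τ h1 h2]; exact h2)).2.comp τ (hQd τ h1 h2)
  · intro y h1 h2
    have hle : Q (F y) ≤ y := (quantile_le_iff (hτ₁0.trans h1) h2 y).2 le_rfl
    rcases hle.lt_or_eq with hlt | heq
    -- Here `F` is flat to the right of `Q (F y)`, so its derivative there would be `0` instead of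
    -- `1 / Q'`.
    · exfalso
      have h3 := (hFd (F y) h1 h2).hasDerivWithinAt (s := Set.Ioi (Q (F y)))
      have h4 : F =ᶠ[𝓝[>] (Q (F y))] fun _ => F y := by
        filter_upwards [Ioo_mem_nhdsGT hlt] with x hx
        refine le_antisymm (hFmono hx.2.le) ?_
        rw [← hFQ (F y) h1 h2]
        exact hFmono hx.1.le
      have h5 := (hasDerivWithinAt_const (Q (F y)) (Set.Ioi (Q (F y))) (F y)).congr_of_eventuallyEq
        h4 (hFQ (F y) h1 h2)
      have h6 := (uniqueDiffWithinAt_Ioi (Q (F y))).eq_deriv _ h3 h5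
      exact inv_ne_zero (hQ' (F y) h1 h2) h6
    · exact heq

/-- The tail quantile function `U x = Q (1 - 1 / x)`. -/
noncomputable def tailQuantile (F : ℝ → ℝ) (x : ℝ) : ℝ := quantile F (1 - 1 / x)

/-- `x ^ (1 - γ) * U' x = exp (L x)` with `L' x = A x / x`, where `U` is the tail quantile function
and `A` is the von Mises rate. -/
structure TailRepresentation (F A L : ℝ → ℝ) (γ x₁ : ℝ) : Prop where
  one_lt : 1 < x₁
  hasDerivAt_tailQuantile : ∀ x, x₁ < x →
    HasDerivAt (tailQuantile F) (x ^ (γ - 1) * Real.exp (L x)) x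
  hasDerivAt_log : ∀ x, x₁ < x → HasDerivAt L (A x / x) x
  apply_tailQuantile : ∀ x, x₁ < x → F (tailQuantile F x) = 1 - 1 / x
  hasDerivAt : ∀ x, x₁ < x →
    HasDerivAt F (x ^ 2 * (x ^ (γ - 1) * Real.exp (L x)))⁻¹ (tailQuantile F x)
  tailQuantile_eq : ∀ y, 1 - 1 / x₁ < F y → F y < 1 → tailQuantile F (1 / (1 - F y)) = y

/-- Since `U' x = Q'(1 - 1/x) / x ^ 2`, the choice is `L x = log Q'(1 - 1/x) - (1 + γ) log x`. Its
derivative is `A x / x` by the definition of the von Mises rate. -/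
theorem VonMisesCondition.exists_tailRepresentation {a : ℝ → ℝ} {γ ρ : ℝ}
    (h : VonMisesCondition (cdf μ) a γ ρ) :
    ∃ x₁ : ℝ, ∃ L : ℝ → ℝ,
      TailRepresentation (cdf μ) (vonMisesRate (quantile (cdf μ)) γ) L γ x₁ := by
  obtain ⟨τ₁, hτ₁0, hτ₁1, hQ, hy⟩ := h.exists_quantile
  set F : ℝ → ℝ := ⇑(cdf μ) with hF
  set Q := quantile F with hQdef
  have h1τ : 0 < 1 - τ₁ := by linarith
  have hx₁ : 1 < 1 / (1 - τ₁) := by rw [lt_div_iff₀ h1τ]; linarith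
  have hpos : ∀ x, 1 / (1 - τ₁) < x → 0 < x := fun x hx => by linarith
  have hlt : ∀ x, 1 / (1 - τ₁) < x → τ₁ < 1 - 1 / x ∧ 1 - 1 / x < 1 := by
    intro x hx
    have hx0 := hpos x hx
    have h1 : 0 < 1 / x := by positivity
    have h2 : 1 / x < 1 - τ₁ := by
      rw [div_lt_iff₀ h1τ] at hx
      rw [div_lt_iff₀ hx0]; linarith
    constructor <;> linarith
  have hderiv : ∀ x, 1 / (1 - τ₁) < x →
      x ^ (γ - 1) * Real.exp (Real.log (deriv Q (1 - 1 / x)) - (1 + γ) * Real.log x)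
        = deriv Q (1 - 1 / x) / x ^ 2 := by
    intro x hx
    have hx0 := hpos x hx
    obtain ⟨hq, -⟩ := hQ _ (hlt x hx).1 (hlt x hx).2
    have h1 : Real.exp ((1 + γ) * Real.log x) = x ^ (1 + γ) := by
      rw [Real.rpow_def_of_pos hx0, mul_comm]
    rw [Real.exp_sub, Real.exp_log hq, h1, ← Real.rpow_natCast x 2]
    have h2 : x ^ (1 + γ) = x ^ (γ - 1) * x ^ ((2 : ℕ) : ℝ) := by
      rw [← Real.rpow_add hx0]; congr 1; push_cast; ring
    rw [h2]
    field_simp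
  have hinner : ∀ x : ℝ, 0 < x → HasDerivAt (fun x : ℝ => 1 - 1 / x) (1 / x ^ 2) x := by
    intro x hx0
    have := (hasDerivAt_inv hx0.ne').const_sub 1
    simpa [one_div] using this
  refine ⟨1 / (1 - τ₁), fun x => Real.log (deriv Q (1 - 1 / x)) - (1 + γ) * Real.log x,
    hx₁, ?_, ?_, ?_, ?_, ?_⟩
  · intro x hx
    obtain ⟨-, hqd, -⟩ := hQ _ (hlt x hx).1 (hlt x hx).2
    rw [hderiv x hx]
    have := hqd.hasDerivAt.comp x (hinner x (hpos x hx))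
    rw [mul_one_div] at this
    exact this
  · intro x hx
    have hx0 := hpos x hx
    obtain ⟨hq, -, hqd, -⟩ := hQ _ (hlt x hx).1 (hlt x hx).2
    have h1 := (hqd.hasDerivAt.comp x (hinner x hx0)).log (by exact hq.ne')
    have h2 := h1.sub ((Real.hasDerivAt_log hx0.ne').const_mul (1 + γ))
    refine h2.congr_deriv ?_
    unfold vonMisesRate
    simp only [Function.comp]
    have h3 := hq.ne'
    set d := deriv Q (1 - 1 / x)
    set e := deriv (deriv Q) (1 - 1 / x)
    field_simp
    ring
  · intro x hx
    exact (hQ _ (hlt x hx).1 (hlt x hx).2).2.2.2.1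
  · intro x hx
    have h1 := (hQ _ (hlt x hx).1 (hlt x hx).2).2.2.2.2
    rw [hderiv x hx, mul_div_cancel₀ _ (pow_ne_zero 2 (hpos x hx).ne')]
    exact h1
  · intro y h1 h2
    have h3 : 0 < 1 - F y := by linarith
    unfold tailQuantile
    simp only [one_div_one_div] at h1 ⊢
    rw [sub_sub_cancel]
    exact hy y (by linarith) h2

end quantile

/-! ### Integrated derivative bounds and the scaling function -/

theorem abs_sub_le_mul_boxCox {f f' : ℝ → ℝ} {b v K : ℝ} (hv : 1 ≤ v)
    (hf : ∀ x, 1 ≤ x → x ≤ v → HasDerivAt f (f' x) x)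
    (hbound : ∀ x, 1 ≤ x → x ≤ v → |f' x| ≤ K * x ^ (b - 1)) :
    |f v - f 1| ≤ K * boxCox b v := by
  -- `boxCox b` is the primitive of `x ^ (b - 1)` vanishing at `1`; this form of the mean value
  -- inequality needs no integrability of `f'`.
  have h := image_norm_le_of_norm_deriv_right_le_deriv_boundary' (a := 1) (b := v)
    (f := fun x => f x - f 1) (f' := f') (B := fun x => K * boxCox b x)
    (B' := fun x => K * x ^ (b - 1))
    (fun x hx => ((hf x hx.1 hx.2).sub_const _).continuousAt.continuousWithinAt)
    (fun x hx => ((hf x hx.1 hx.2.le).sub_const _).hasDerivWithinAt)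
    (by simp [boxCox_one])
    (fun x hx => ((hasDerivAt_boxCox b (by linarith [hx.1])).const_mul K).continuousAt.continuousWithinAt)
    (fun x hx => ((hasDerivAt_boxCox b (by linarith [hx.1])).const_mul K).hasDerivWithinAt)
    (fun x hx => hbound x hx.1 hx.2.le)
  exact h ⟨hv, le_rfl⟩

theorem boxCox_nonneg (b : ℝ) {v : ℝ} (hv : 1 ≤ v) : 0 ≤ boxCox b v := by
  have h := abs_sub_le_mul_boxCox (f := fun _ => 0) (f' := fun _ => 0) (b := b) (K := 1) hv
    (fun x _ _ => hasDerivAt_const _ _) (fun x hx _ => by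
      rw [abs_zero, one_mul]; exact Real.rpow_nonneg (by linarith) _)
  simpa using h

theorem boxCox_pos (b : ℝ) {v : ℝ} (hv : 1 < v) : 0 < boxCox b v := by
  unfold boxCox
  split_ifs with h
  · exact Real.log_pos hv
  · rcases lt_or_gt_of_ne h with h | h
    · exact div_pos_of_neg_of_neg (by linarith [Real.rpow_lt_one_of_one_lt_of_neg hv h]) h
    · exact div_pos (by linarith [Real.one_lt_rpow hv h]) h

theorem gpQuantile_one_div (γ : ℝ) {v : ℝ} (hv : 0 < v) :
    gpQuantile γ (1 / v) = boxCox γ v := by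
  unfold gpQuantile boxCox
  split_ifs
  · rw [one_div, Real.log_inv, neg_neg]
  · rw [one_div, Real.inv_rpow hv.le, Real.rpow_neg hv.le, inv_inv]

namespace TailRepresentation

variable {F A L : ℝ → ℝ} {γ x₁ : ℝ}

theorem abs_log_sub_le (h : TailRepresentation F A L γ x₁) {t v K δ : ℝ} (ht : x₁ < t)
    (hv : 1 ≤ v) (hA : ∀ x, 1 ≤ x → |A (t * x)| ≤ K * x ^ δ) :
    |L (t * v) - L t| ≤ K * boxCox δ v := by
  have ht0 : 0 < t := by linarith [h.one_lt]
  have := abs_sub_le_mul_boxCox (f := fun x => L (t * x)) (f' := fun x => A (t * x) / x)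
    (b := δ) (K := K) hv (fun x hx _ => ?_) (fun x hx _ => ?_)
  · simpa using this
  · have h1 := (h.hasDerivAt_log (t * x) (by nlinarith)).comp x ((hasDerivAt_id x).const_mul t)
    refine h1.congr_deriv ?_
    have : x ≠ 0 := by linarith
    field_simp
  · have hx0 : 0 < x := by linarith
    rw [abs_div, abs_of_pos hx0, div_le_iff₀ hx0, mul_assoc, Real.rpow_sub_one hx0.ne',
      div_mul_cancel₀ _ hx0.ne']
    exact hA x hx

theorem hasDerivAt_comp_mul (h : TailRepresentation F A L γ x₁) {t x : ℝ} (ht : 0 < t)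
    (hx : 0 < x) (htx : x₁ < t * x) :
    HasDerivAt (fun x => tailQuantile F (t * x))
      (t ^ γ * Real.exp (L t) * (x ^ (γ - 1) * Real.exp (L (t * x) - L t))) x := by
  have h1 := (h.hasDerivAt_tailQuantile (t * x) htx).comp x ((hasDerivAt_id x).const_mul t)
  refine h1.congr_deriv ?_
  rw [Real.mul_rpow ht.le hx.le, Real.exp_sub, Real.rpow_sub_one ht.ne']
  have := Real.exp_pos (L t)
  field_simp

/-- The scaling function of the second-order condition is `t ^ γ * exp (L t) * (1 + O(A t))`. -/
theorem exists_abs_div_sub_one_le {a : ℝ → ℝ} {ρ : ℝ} (h : TailRepresentation F A L γ x₁)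
    (ha : ∀ᶠ t in atTop, 0 < a t) (hSO : SecondOrder (quantile F) a A γ ρ) :
    ∃ C T : ℝ, 0 < C ∧ ∀ t, T ≤ t → |a t / (t ^ γ * Real.exp (L t)) - 1| ≤ C * |A t| := by
  obtain ⟨hρ, hA0, hRV, hlim⟩ := hSO
  obtain ⟨C₀, T₀, hC₀, hgrow⟩ := hRV.exists_le_mul_rpow (δ := 1) hρ zero_le_one (by linarith)
  -- The single value `x = 1/2`, that is the increment `U (2t) - U t`, identifies the scale: it is
  -- `a t * c` by the second-order condition and `a₀ * c` by integrating `U'`, each with relative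
  -- error `O(A t)`. Only finiteness of the limit is used.
  have hlim2 := (hlim (1 / 2) (by norm_num)).comp tendsto_inv_atTop_nhdsGT_zero
  set ℓ := ∫ v in (1 : ℝ)..(1 / (1 / 2)), v ^ (γ - 1) * ∫ r in (1 : ℝ)..v, r ^ (ρ - 1)
  have hev1 := (hlim2.abs).eventually_le_const (lt_add_one |ℓ|)
  set c := boxCox γ 2 with hc
  have hc0 : 0 < c := boxCox_pos γ one_lt_two
  set M := |ℓ| + 1
  have hM : 0 < M := by positivity
  have hA0' : Tendsto (fun t => |A t|) atTop (𝓝 0) := by simpa using hA0.abs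
  have hbd : 0 < min (1 / C₀) (c / 2 / M) := by positivity
  obtain ⟨T, hT⟩ := eventually_atTop.1 (hev1.and (ha.and (hRV.2.1.and
    ((hA0'.eventually_le_const hbd).and ((eventually_ge_atTop T₀).and
      (eventually_gt_atTop x₁))))))
  refine ⟨(2 * C₀ * c + M) / (c / 2), T, by positivity, fun t ht => ?_⟩
  obtain ⟨h1, hat, hAt, hAs, hT₀, hx₁⟩ := hT t ht
  have hAs1 : C₀ * |A t| ≤ 1 := by
    have := (hAs.trans (min_le_left _ _)); rw [le_div_iff₀ hC₀] at this; linarith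
  have hAs2 : M * |A t| ≤ c / 2 := by
    have := (hAs.trans (min_le_right _ _)); rw [le_div_iff₀ hM] at this; linarith
  have ht1 : 1 < t := h.one_lt.trans hx₁
  have ht0 : 0 < t := by linarith
  set a₀ := t ^ γ * Real.exp (L t) with ha₀
  have ha₀pos : 0 < a₀ := by positivity
  set D := tailQuantile F (t * 2) - tailQuantile F t with hD
  have hd2 : |D / a t - c| ≤ M * |A t| := by
    have h2 : 1 - t⁻¹ * (1 / 2) = 1 - 1 / (t * 2) := by field_simp
    have h3 : D = quantile F (1 - t⁻¹ * (1 / 2)) - quantile F (1 - t⁻¹) := by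
      rw [hD, tailQuantile, tailQuantile, one_div t, h2]
    simp only [Function.comp] at h1
    rw [one_div t⁻¹, inv_inv, abs_mul, abs_div, abs_one, one_div_mul_eq_div, div_le_iff₀ hAt] at h1
    rw [h3, hc, ← gpQuantile_one_div γ two_pos]
    exact h1
  have hd1 : |D / a₀ - c| ≤ 2 * (C₀ * |A t|) * c := by
    have h2 := abs_sub_le_mul_boxCox (b := γ) (v := 2) (K := 2 * (C₀ * |A t|))
      (f := fun x => tailQuantile F (t * x) / a₀ - boxCox γ x)
      (f' := fun x => x ^ (γ - 1) * (Real.exp (L (t * x) - L t) - 1)) one_le_two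
      (fun x hx _ => ?_) (fun x hx hx2 => ?_)
    · have h3 : tailQuantile F (t * 2) / a₀ - boxCox γ 2
          - (tailQuantile F (t * 1) / a₀ - boxCox γ 1) = D / a₀ - c := by
        rw [boxCox_one, mul_one, hD, hc]; ring
      rw [← h3]; exact h2
    · have hx0 : 0 < x := by linarith
      have h3 := ((h.hasDerivAt_comp_mul ht0 hx0 (by nlinarith)).div_const a₀).sub
        (hasDerivAt_boxCox γ hx0)
      refine h3.congr_deriv ?_
      rw [mul_div_cancel_left₀ _ ha₀pos.ne']
      ring
    · have hx0 : 0 < x := by linarith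
      have h3 := h.abs_log_sub_le hx₁ hx (K := C₀ * |A t|) (δ := 1) (fun y hy => by
        have := hgrow t hT₀ y hy
        linarith)
      have h4 : boxCox 1 x ≤ 1 := by simp [boxCox]; linarith
      have h5 : |L (t * x) - L t| ≤ C₀ * |A t| :=
        h3.trans (mul_le_of_le_one_right (by positivity) h4)
      have h6 := Real.abs_exp_sub_one_le (h5.trans hAs1)
      rw [abs_mul, abs_of_pos (Real.rpow_pos_of_pos hx0 _), mul_comm]
      gcongr
      linarith
  have hDpos : c / 2 ≤ D / a t := by linarith [(abs_le.1 hd2).1]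
  have hD0 : 0 < D / a t := by linarith
  have h7 : a t / a₀ - 1 = (D / a₀ - c - (D / a t - c)) / (D / a t) := by
    have : D ≠ 0 := by rintro h0; rw [h0] at hD0; simp at hD0
    field_simp
    ring
  rw [h7, abs_div, abs_of_pos hD0, div_le_iff₀ hD0]
  calc |D / a₀ - c - (D / a t - c)| ≤ |D / a₀ - c| + |D / a t - c| := abs_sub _ _
    _ ≤ 2 * (C₀ * |A t|) * c + M * |A t| := by gcongr
    _ = (2 * C₀ * c + M) / (c / 2) * |A t| * (c / 2) := by field_simp
    _ ≤ _ := by gcongr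

end TailRepresentation

/-! ### The density of peaks above a high threshold -/

section predictive

theorem cond_real_apply' {α : Type*} [MeasurableSpace α] (ν : Measure α) {s : Set α}
    (hs : MeasurableSet s) (u : Set α) : (ν[|s]).real u = (ν.real s)⁻¹ * ν.real (s ∩ u) := by
  simp only [Measure.real, cond_apply hs, ENNReal.toReal_mul, ENNReal.toReal_inv]

variable {μ : Measure ℝ}

theorem predictiveCdf_mono (t : ℝ) : Monotone (predictiveCdf μ t) := fun y z hyz => by
  unfold predictiveCdf
  exact measureReal_mono (Set.Iic_subset_Iic.2 hyz)

theorem predictiveCdf_of_le [IsProbabilityMeasure μ] {t y : ℝ} (hty : t ≤ y) :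
    predictiveCdf μ t y = (cdf μ y - cdf μ t) / (1 - cdf μ t) := by
  have h1 : μ.real (Set.Ioi t) = 1 - cdf μ t := by
    rw [cdf_eq_real, ← Set.compl_Iic, probReal_compl_eq_one_sub measurableSet_Iic]
  have h2 : μ.real (Set.Ioi t ∩ Set.Iic y) = cdf μ y - cdf μ t := by
    rw [cdf_eq_real, cdf_eq_real, Set.Ioi_inter_Iic, ← Set.Iic_union_Ioc_eq_Iic hty,
      measureReal_union (Set.Iic_disjoint_Ioc le_rfl) measurableSet_Ioc, add_sub_cancel_left]
  unfold predictiveCdf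
  rw [cond_real_apply' _ measurableSet_Ioi, h1, h2, inv_mul_eq_div]

theorem predictiveDensity_of_lt {t y : ℝ} (hyt : y < t) : predictiveDensity μ t y = 0 := by
  unfold predictiveDensity
  have h : predictiveCdf μ t =ᶠ[𝓝 y] fun _ => 0 := by
    filter_upwards [Iio_mem_nhds hyt] with z hz
    have hz : z < t := hz
    unfold predictiveCdf
    rw [cond_real_apply' _ measurableSet_Ioi, Set.Ioi_inter_Iic, Set.Ioc_eq_empty (by linarith)]
    simp
  rw [h.deriv_eq]
  exact deriv_const _ _

/-- Given exceedance of `U (t s)`, the probability of exceeding `U (t v)` is `s / v`, the Pareto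
tail. -/
theorem TailRepresentation.isParetoImage [IsProbabilityMeasure μ] {A L : ℝ → ℝ} {γ x₁ t s : ℝ}
    (h : TailRepresentation (cdf μ) A L γ x₁) (ht : 0 < t) (hs : 0 < s) (hts : x₁ < t * s) :
    IsParetoImage s (predictiveDensity μ (tailQuantile (cdf μ) (t * s)))
      (fun v => tailQuantile (cdf μ) (t * v))
      (fun v => t ^ γ * Real.exp (L t) * (v ^ (γ - 1) * Real.exp (L (t * v) - L t))) := by
  set F : ℝ → ℝ := ⇑(cdf μ) with hF
  have hFm : Monotone F := monotone_cdf μ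
  have htv : ∀ v, s < v → x₁ < t * v := fun v hv => by nlinarith
  have hts0 : 0 < t * s := by positivity
  have hFs : F (tailQuantile F (t * s)) = 1 - 1 / (t * s) := h.apply_tailQuantile _ hts
  constructor
  · exact fun v hv => h.hasDerivAt_comp_mul ht (hs.trans hv) (htv v hv)
  · intro v hv
    have := hs.trans hv
    positivity
  · intro v hv
    have hv0 := hs.trans hv
    have hFv := h.apply_tailQuantile _ (htv v hv)
    have hlt : tailQuantile F (t * s) < tailQuantile F (t * v) := by
      by_contra! hle
      have h1 := hFm hle
      rw [hFs, hFv] at h1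
      have h2 : 1 / (t * v) < 1 / (t * s) := by gcongr
      linarith
    have hd : HasDerivAt (predictiveCdf μ (tailQuantile F (t * s)))
        (((t * v) ^ 2 * ((t * v) ^ (γ - 1) * Real.exp (L (t * v))))⁻¹ / (1 / (t * s)))
        (tailQuantile F (t * v)) := by
      have h1 := ((h.hasDerivAt _ (htv v hv)).sub_const (F (tailQuantile F (t * s)))).div_const
        (1 - F (tailQuantile F (t * s)))
      rw [hFs, sub_sub_cancel] at h1
      refine h1.congr_of_eventuallyEq ?_
      filter_upwards [Ioi_mem_nhds hlt] with z hz
      rw [predictiveCdf_of_le (le_of_lt hz), ← hF, hFs, sub_sub_cancel]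
    unfold predictiveDensity
    rw [hd.deriv, Real.mul_rpow ht.le hv0.le, Real.exp_sub, Real.rpow_sub_one ht.ne',
      show (-2 : ℝ) = -(2 : ℕ) by norm_num, Real.rpow_neg hv0.le, Real.rpow_natCast]
    have h1 := Real.exp_pos (L t)
    have h2 := Real.exp_pos (L (t * v))
    have h3 := Real.rpow_pos_of_pos ht γ
    have h4 := Real.rpow_pos_of_pos hv0 (γ - 1)
    field_simp
  · exact fun y => (predictiveCdf_mono _).deriv_nonneg
  -- Two points are discarded: the first point where `F` reaches `1`, if any, and the threshold.
  -- Elsewhere outside the image the conditional distribution function is locally constant; points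
  -- above the threshold with `F y < 1` lie in the image.
  · set E : Set ℝ := {y | F y = 1 ∧ ∀ z, z < y → F z ≠ 1} with hE
    have hE0 : volume E = 0 := by
      apply Set.Subsingleton.measure_zero
      intro y hy z hz
      rcases lt_trichotomy y z with hlt | heq | hgt
      · exact absurd hy.1 (hz.2 y hlt)
      · exact heq
      · exact absurd hz.1 (hy.2 z hgt)
    have h1 : ∀ᵐ y, y ∉ E := measure_eq_zero_iff_ae_notMem.1 hE0
    have h2 : ∀ᵐ y : ℝ, y ∉ ({tailQuantile F (t * s)} : Set ℝ) :=
      measure_eq_zero_iff_ae_notMem.1 (by simp)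
    filter_upwards [h1, h2] with y hyE hyt hy
    rcases lt_or_gt_of_ne (by simpa using hyt) with hlt | hgt
    · exact predictiveDensity_of_lt hlt
    · by_cases hF1 : F y = 1
      · obtain ⟨z, hzy, hz⟩ : ∃ z, z < y ∧ F z = 1 := by
          by_contra! hcon
          exact hyE ⟨hF1, hcon⟩
        unfold predictiveDensity
        have h3 : predictiveCdf μ (tailQuantile F (t * s)) =ᶠ[𝓝 y] fun _ => 1 := by
          filter_upwards [Ioi_mem_nhds hgt, Ioi_mem_nhds hzy] with x hx hzx
          have hFx : F x = 1 :=
            le_antisymm (cdf_le_one μ x) (hz.symm.le.trans (hFm (le_of_lt hzx)))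
          rw [predictiveCdf_of_le (le_of_lt hx), ← hF, hFx, div_self]
          rw [hFs, sub_sub_cancel]
          positivity
        rw [h3.deriv_eq]
        exact deriv_const _ _
      · exfalso
        have hFlt : F y < 1 := lt_of_le_of_ne (cdf_le_one μ y) hF1
        have hFle := hFm (le_of_lt hgt)
        rw [hFs] at hFle
        have hx₁0 : 0 < x₁ := by linarith [h.one_lt]
        have h3 : 1 / (t * s) < 1 / x₁ := by gcongr
        have h4 := h.tailQuantile_eq y (by linarith) hFlt
        have h5 : 0 < 1 - F y := by linarith
        apply hy
        refine ⟨1 / (1 - F y) / t, ?_, ?_⟩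
        · have h6 : t * s ≤ 1 / (1 - F y) := by
            rw [le_div_iff₀ h5]
            have : 1 - F y ≤ 1 / (t * s) := by linarith
            calc t * s * (1 - F y) ≤ t * s * (1 / (t * s)) := by gcongr
              _ = 1 := by field_simp
          rw [Set.mem_Ioi, lt_div_iff₀ ht]
          rcases h6.lt_or_eq with h7 | h7
          · linarith
          · rw [← h7] at h4
            exact absurd h4 hgt.ne
        · simp only
          rw [mul_div_cancel₀ _ ht.ne']
          exact h4

end predictive

/-! ### Intermediate order statistics -/

/-- Reduces the order statistic to a sum of iid indicators. Rank `n - k` is position `n - k - 1` in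
the zero-based sorted sample. -/
theorem orderStat_le_iff {n k : ℕ} (hkn : k < n) (x : ℕ → ℝ) (c : ℝ) :
    orderStat n x (n - k) ≤ c ↔ ∑ i ∈ Finset.range n, (Set.Ioi c).indicator 1 (x i) ≤ (k : ℝ) := by
  have hj : 1 ≤ n - k ∧ n - k ≤ n := ⟨by omega, by omega⟩
  set f : Fin n → ℝ := fun i => x i with hf
  have h1 : orderStat n x (n - k) = (f ∘ Tuple.sort f) ⟨n - k - 1, by omega⟩ := by
    unfold orderStat
    rw [dif_pos hj]
    rfl
  have h2 := Tuple.lt_card_le_iff_apply_le_of_monotone (f := f ∘ Tuple.sort f) (a := c)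
    (j := ⟨n - k - 1, by omega⟩) (Tuple.monotone_sort f)
  rw [h1, ← h2]
  have h3 : (Finset.univ.filter fun i => (f ∘ Tuple.sort f) i ≤ c).card
      = (Finset.univ.filter fun i => f i ≤ c).card := by
    apply Finset.card_bij (fun i _ => Tuple.sort f i)
    · intro i hi; simpa using hi
    · intro i _ j _ hij; exact (Tuple.sort f).injective hij
    · intro i hi
      exact ⟨(Tuple.sort f).symm i, by simpa using hi, by simp⟩
  have h4 : (Finset.univ.filter fun i => f i ≤ c).card
      + (Finset.univ.filter fun i => ¬ f i ≤ c).card = n := by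
    rw [Finset.card_filter_add_card_filter_not]; simp
  have h5 : ∑ i ∈ Finset.range n, (Set.Ioi c).indicator (1 : ℝ → ℝ) (x i)
      = ((Finset.univ.filter fun i => ¬ f i ≤ c).card : ℝ) := by
    rw [Finset.sum_range, Finset.card_filter, Nat.cast_sum]
    refine Finset.sum_congr rfl fun i _ => ?_
    simp [Set.indicator_apply, hf]
  rw [h5, Nat.cast_le, h3]
  simp only
  omega

section sample

variable {Ω : Type*} [MeasurableSpace Ω] {P : Measure Ω} [IsProbabilityMeasure P]
  {μ : Measure ℝ} [IsProbabilityMeasure μ] {X : ℕ → Ω → ℝ}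

/-- Chebyshev's inequality; the variance of an indicator is at most its mean. -/
theorem measure_le_abs_sum_indicator_sub_le (hXmeas : ∀ i, Measurable (X i))
    (hXindep : iIndepFun X P) (hXlaw : ∀ i, P.map (X i) = μ) (n : ℕ) (c : ℝ) {d : ℝ} (hd : 0 < d) :
    P {ω | d ≤ |∑ i ∈ Finset.range n, (Set.Ioi c).indicator 1 (X i ω) - n * (1 - cdf μ c)|}
      ≤ ENNReal.ofReal (n * (1 - cdf μ c) / d ^ 2) := by
  set g : ℝ → ℝ := (Set.Ioi c).indicator 1 with hg
  have hgm : Measurable g := measurable_one.indicator measurableSet_Ioi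
  set Y : ℕ → Ω → ℝ := fun i ω => g (X i ω) with hY
  have hYm : ∀ i, Measurable (Y i) := fun i => hgm.comp (hXmeas i)
  have hg01 : ∀ x, g x = 0 ∨ g x = 1 := fun x => by
    by_cases hx : x ∈ Set.Ioi c
    · right; simp [hg, hx]
    · left; simp [hg, hx]
  have hYL : ∀ i, MemLp (Y i) 2 P := fun i => by
    refine MemLp.of_bound (hYm i).aestronglyMeasurable 1 (Eventually.of_forall fun ω => ?_)
    rcases hg01 (X i ω) with h | h <;> simp [hY, h]
  have hEY : ∀ i, P[Y i] = 1 - cdf μ c := fun i => by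
    have h1 : P[Y i] = ∫ x, g x ∂μ := by
      rw [← hXlaw i, integral_map (hXmeas i).aemeasurable hgm.aestronglyMeasurable]
    rw [h1, hg, integral_indicator_one measurableSet_Ioi, cdf_eq_real, ← Set.compl_Iic,
      probReal_compl_eq_one_sub measurableSet_Iic]
  have hVY : ∀ i, variance (Y i) P ≤ 1 - cdf μ c := fun i => by
    refine (variance_le_expectation_sq (hYm i).aestronglyMeasurable).trans ?_
    rw [← hEY i]
    apply le_of_eq
    congr 1
    funext ω
    rcases hg01 (X i ω) with h | h <;> simp [hY, h]
  have hS : MemLp (∑ i ∈ Finset.range n, Y i) 2 P := memLp_finsetSum' _ fun i _ => hYL i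
  have hES : P[∑ i ∈ Finset.range n, Y i] = n * (1 - cdf μ c) := by
    have h1 : ∀ ω, (∑ i ∈ Finset.range n, Y i) ω = ∑ i ∈ Finset.range n, Y i ω := fun ω => by simp
    simp only [h1]
    rw [integral_finsetSum _ fun i _ => (hYL i).integrable (by norm_num)]
    simp only [hEY, Finset.sum_const, Finset.card_range, nsmul_eq_mul]
  have hVS : variance (∑ i ∈ Finset.range n, Y i) P ≤ n * (1 - cdf μ c) := by
    rw [IndepFun.variance_sum (fun i _ => hYL i) fun i _ j _ hij =>
      (hXindep.indepFun hij).comp hgm hgm]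
    calc ∑ i ∈ Finset.range n, variance (Y i) P ≤ ∑ i ∈ Finset.range n, (1 - cdf μ c) :=
          Finset.sum_le_sum fun i _ => hVY i
      _ = _ := by simp only [Finset.sum_const, Finset.card_range, nsmul_eq_mul]
  have h := meas_ge_le_variance_div_sq hS hd
  rw [hES] at h
  simp only [Finset.sum_apply] at h
  refine h.trans (ENNReal.ofReal_le_ofReal ?_)
  gcongr

theorem measure_lt_orderStat_le (hXmeas : ∀ i, Measurable (X i))
    (hXindep : iIndepFun X P) (hXlaw : ∀ i, P.map (X i) = μ) {n k : ℕ} (hkn : k < n) {c : ℝ}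
    (hc : n * (1 - cdf μ c) < k) :
    P {ω | c < orderStat n (fun i => X i ω) (n - k)}
      ≤ ENNReal.ofReal (n * (1 - cdf μ c) / (k - n * (1 - cdf μ c)) ^ 2) := by
  refine le_trans (measure_mono fun ω hω => ?_) (measure_le_abs_sum_indicator_sub_le hXmeas hXindep
    hXlaw n c (d := k - n * (1 - cdf μ c)) (by linarith))
  have hω : c < orderStat n (fun i => X i ω) (n - k) := hω
  rw [← not_le, orderStat_le_iff hkn, not_le] at hω
  rw [Set.mem_ofPred_eq]
  refine le_trans ?_ (le_abs_self _)
  linarith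

theorem measure_orderStat_le_le (hXmeas : ∀ i, Measurable (X i))
    (hXindep : iIndepFun X P) (hXlaw : ∀ i, P.map (X i) = μ) {n k : ℕ} (hkn : k < n) {c : ℝ}
    (hc : k < n * (1 - cdf μ c)) :
    P {ω | orderStat n (fun i => X i ω) (n - k) ≤ c}
      ≤ ENNReal.ofReal (n * (1 - cdf μ c) / (n * (1 - cdf μ c) - k) ^ 2) := by
  refine le_trans (measure_mono fun ω hω => ?_) (measure_le_abs_sum_indicator_sub_le hXmeas hXindep
    hXlaw n c (d := n * (1 - cdf μ c) - k) (by linarith))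
  have hω : orderStat n (fun i => X i ω) (n - k) ≤ c := hω
  rw [orderStat_le_iff hkn] at hω
  rw [Set.mem_ofPred_eq]
  refine le_trans ?_ (neg_le_abs _)
  linarith

theorem TailRepresentation.exists_abs_sub_le {F A L : ℝ → ℝ} {γ x₁ : ℝ}
    (h : TailRepresentation F A L γ x₁) (hA : Tendsto A atTop (𝓝 0)) :
    ∃ C T : ℝ, 0 < C ∧ ∀ t, T ≤ t → ∀ x ∈ Set.Icc (1 / 2 : ℝ) 2,
      |tailQuantile F (t * x) - tailQuantile F t| ≤ C * (t ^ γ * Real.exp (L t)) * |x - 1| := by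
  have hA1 : Tendsto (fun t => |A t|) atTop (𝓝 0) := by simpa using hA.abs
  obtain ⟨T, hT⟩ := eventually_atTop.1 (hA1.eventually_le_const one_pos)
  obtain ⟨B, hB⟩ : ∃ B, ∀ x ∈ Set.Icc (1 / 2 : ℝ) 2, |x ^ (γ - 1)| ≤ B := by
    have hc : ContinuousOn (fun x : ℝ => x ^ (γ - 1)) (Set.Icc (1 / 2 : ℝ) 2) := fun x hx =>
      (Real.continuousAt_rpow_const x _ (Or.inl (by linarith [hx.1]))).continuousWithinAt
    exact isCompact_Icc.exists_bound_of_continuousOn hc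
  have hB0 : 0 ≤ B := (abs_nonneg _).trans (hB 1 (by norm_num))
  refine ⟨B * Real.exp 1 + 1, 2 * (max T x₁ + 1), by positivity, fun t ht x hx => ?_⟩
  have hx₁ := h.one_lt
  have hm1 := le_max_left T x₁
  have hm2 := le_max_right T x₁
  have ht0 : 0 < t := by linarith
  have htx : ∀ y ∈ Set.Icc (1 / 2 : ℝ) 2, max T x₁ < t * y := fun y hy => by nlinarith [hy.1]
  have hLdiff : ∀ y ∈ Set.Icc (1 / 2 : ℝ) 2, |L (t * y) - L t| ≤ 1 := by
    intro y hy
    have hy0 : 0 < y := by linarith [hy.1]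
    have key : ∀ u v : ℝ, max T x₁ < u → 1 ≤ v → v ≤ 2 → |L (u * v) - L u| ≤ 1 := by
      intro u v hu hv hv2
      have hu0 : 0 < u := by linarith
      have h1 := h.abs_log_sub_le (K := 1) (δ := 1) (by linarith : x₁ < u) hv (fun z hz => by
        rw [one_mul, Real.rpow_one]
        exact (hT _ (by nlinarith)).trans hz)
      have h2 : boxCox 1 v ≤ 1 := by simp [boxCox]; linarith
      linarith
    rcases le_total 1 y with h1 | h1
    · exact key t y (by linarith) h1 hy.2
    -- For `y < 1` the increment of `L` is read upwards, from `t * y` to `t`.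
    · have h2 := key (t * y) (1 / y) (htx y hy) (by rw [le_div_iff₀ hy0]; linarith)
        (by rw [div_le_iff₀ hy0]; linarith [hy.1])
      rw [show t * y * (1 / y) = t by field_simp, abs_sub_comm] at h2
      exact h2
  have hconv := (convex_Icc (1 / 2 : ℝ) 2).norm_image_sub_le_of_norm_hasDerivWithin_le
    (f := fun y => tailQuantile F (t * y))
    (f' := fun y => t ^ γ * Real.exp (L t) * (y ^ (γ - 1) * Real.exp (L (t * y) - L t)))
    (C := (B * Real.exp 1 + 1) * (t ^ γ * Real.exp (L t)))
    (fun y hy => (h.hasDerivAt_comp_mul ht0 (by linarith [hy.1])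
      (by linarith [htx y hy])).hasDerivWithinAt)
    (fun y hy => ?_) (show (1 : ℝ) ∈ Set.Icc (1 / 2 : ℝ) 2 by norm_num) hx
  · simpa using hconv
  · have ha : 0 < t ^ γ * Real.exp (L t) := by positivity
    rw [Real.norm_eq_abs, abs_mul, abs_of_pos ha, abs_mul, Real.abs_exp, mul_comm]
    gcongr
    calc |y ^ (γ - 1)| * Real.exp (L (t * y) - L t) ≤ B * Real.exp 1 := by
          gcongr
          · exact hB y hy
          · exact (abs_le.1 (hLdiff y hy)).2
      _ ≤ _ := by linarith

/-- Intermediate order statistics are consistent at rate `1 / √k` relative to the scale. -/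
theorem isBigOP_orderStat_sub (hXmeas : ∀ i, Measurable (X i))
    (hXindep : iIndepFun X P) (hXlaw : ∀ i, P.map (X i) = μ) {A L : ℝ → ℝ} {γ x₁ : ℝ}
    (h : TailRepresentation (cdf μ) A L γ x₁) (hA : Tendsto A atTop (𝓝 0))
    {k : ℕ → ℕ} (hk : Tendsto k atTop atTop)
    (hkn : Tendsto (fun n : ℕ => (n : ℝ) / k n) atTop atTop) :
    IsBigOP P (fun n ω => (orderStat n (fun i => X i ω) (n - k n) - tailQuantile (cdf μ) (n / k n))
        / ((n / k n : ℝ) ^ γ * Real.exp (L (n / k n))))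
      (fun n => 1 / Real.sqrt (k n)) := by
  intro δ hδ
  obtain ⟨C, T, hC, hCT⟩ := h.exists_abs_sub_le hA
  -- At the levels `U (t (1 ± e))` with `e = M/√k`, the mean exceedance counts are `k / (1 ± e)`.
  -- Chebyshev then gives probabilities `(1 ± e) / (k e²)` with `k e² = M²`, whose sum is `2 / M² =
  -- 2δ/3`.
  set M := Real.sqrt (3 / δ) with hM
  have hM0 : 0 < M := by positivity
  have hM2 : M ^ 2 = 3 / δ := Real.sq_sqrt (by positivity)
  refine ⟨C * M, by positivity, ?_⟩
  have hkR : Tendsto (fun n => Real.sqrt (k n)) atTop atTop :=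
    Real.tendsto_sqrt_atTop.comp (tendsto_natCast_atTop_atTop.comp hk)
  filter_upwards [hk.eventually_ge_atTop 1, hkR.eventually_ge_atTop (2 * M),
    hkn.eventually_ge_atTop T, hkn.eventually_gt_atTop (2 * x₁)] with n hk1 hkM hT hx₁
  have hx₁1 := h.one_lt
  set t : ℝ := n / k n with ht
  have hk0 : (0 : ℝ) < k n := by exact_mod_cast hk1
  set r := Real.sqrt (k n) with hr
  have hr0 : 0 < r := by positivity
  have hr2 : r ^ 2 = k n := Real.sq_sqrt hk0.le
  have ht0 : 0 < t := by linarith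
  have htk : t * k n = n := by rw [ht]; field_simp
  have hlt : k n < n := by
    have : (k n : ℝ) < n := by rw [← htk]; nlinarith
    exact_mod_cast this
  set e := M / r with he
  have he0 : 0 < e := by positivity
  have hene : e ≠ 0 := he0.ne'
  have he2 : e ≤ 1 / 2 := by rw [he, div_le_iff₀ hr0]; linarith
  have hke : k n * e ^ 2 = 3 / δ := by rw [he, div_pow, hr2, hM2]; field_simp
  set a₀ := t ^ γ * Real.exp (L t) with ha₀
  have ha₀0 : 0 < a₀ := by positivity
  have hcdf : ∀ x : ℝ, 1 / 2 ≤ x → n * (1 - cdf μ (tailQuantile (cdf μ) (t * x))) = k n / x := by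
    intro x hx
    have hx0 : 0 < x := by linarith
    rw [h.apply_tailQuantile _ (by nlinarith), sub_sub_cancel, ← htk]
    field_simp
  have h1 := hcdf (1 + e) (by linarith)
  have h2 := hcdf (1 - e) (by linarith)
  have h1e : 0 < 1 - e := by linarith
  have hup := measure_lt_orderStat_le (P := P) (X := X) hXmeas hXindep hXlaw hlt
    (c := tailQuantile (cdf μ) (t * (1 + e))) (by
      rw [h1, div_lt_iff₀ (by linarith)]; nlinarith)
  have hdn := measure_orderStat_le_le (P := P) (X := X) hXmeas hXindep hXlaw hlt
    (c := tailQuantile (cdf μ) (t * (1 - e))) (by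
      rw [h2, lt_div_iff₀ (by linarith)]; nlinarith)
  have h3 : (k n : ℝ) / (1 + e) / (k n - k n / (1 + e)) ^ 2 = (1 + e) / (k n * e ^ 2) := by
    rw [show (k n : ℝ) - k n / (1 + e) = k n * e / (1 + e) by field_simp; ring]
    field_simp
  have h4 : (k n : ℝ) / (1 - e) / (k n / (1 - e) - k n) ^ 2 = (1 - e) / (k n * e ^ 2) := by
    rw [show (k n : ℝ) / (1 - e) - k n = k n * e / (1 - e) by field_simp; ring]
    field_simp
  rw [h1, h3, hke] at hup
  rw [h2, h4, hke] at hdn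
  have hsub : {ω | C * M * (1 / r) <
      |(orderStat n (fun i => X i ω) (n - k n) - tailQuantile (cdf μ) t) / a₀|} ⊆
      {ω | tailQuantile (cdf μ) (t * (1 + e)) < orderStat n (fun i => X i ω) (n - k n)} ∪
      {ω | orderStat n (fun i => X i ω) (n - k n) ≤ tailQuantile (cdf μ) (t * (1 - e))} := by
    intro ω hω
    by_contra hcon
    simp only [Set.mem_union, Set.mem_ofPred_eq, not_or, not_lt, not_le] at hcon hω
    obtain ⟨hc1, hc2⟩ := hcon
    rw [abs_div, abs_of_pos ha₀0, lt_div_iff₀ ha₀0] at hω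
    apply absurd hω (not_lt.2 _)
    have h5 := hCT t hT (1 + e) ⟨by linarith, by linarith⟩
    have h6 := hCT t hT (1 - e) ⟨by linarith, by linarith⟩
    rw [add_sub_cancel_left, abs_of_pos he0] at h5
    rw [show 1 - e - 1 = -e by ring, abs_neg, abs_of_pos he0] at h6
    have h7 : C * M * (1 / r) * a₀ = C * a₀ * e := by rw [he]; ring
    rw [h7, abs_le]
    constructor
    · linarith [(abs_le.1 h6).1]
    · linarith [(abs_le.1 h5).2]
  calc P _ ≤ _ := measure_mono hsub
    _ ≤ _ := measure_union_le _ _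
    _ ≤ ENNReal.ofReal ((1 + e) / (3 / δ)) + ENNReal.ofReal ((1 - e) / (3 / δ)) := by gcongr
    _ = ENNReal.ofReal ((1 + e) / (3 / δ) + (1 - e) / (3 / δ)) :=
      (ENNReal.ofReal_add (by positivity) (by positivity)).symm
    _ ≤ ENNReal.ofReal δ := by
      apply ENNReal.ofReal_le_ofReal
      have : (1 + e) / (3 / δ) + (1 - e) / (3 / δ) = 2 / 3 * δ := by field_simp; ring
      rw [this]
      linarith

end sample

/-! ### Deviations of the tail quantile function from the generalized Pareto quantile function -/

theorem boxCox_zero (v : ℝ) : boxCox 0 v = Real.log v := by simp [boxCox]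

theorem boxCox_mono (b : ℝ) {u v : ℝ} (hu : 0 < u) (huv : u ≤ v) : boxCox b u ≤ boxCox b v := by
  unfold boxCox
  split_ifs with h
  · exact Real.log_le_log hu huv
  · rcases lt_or_gt_of_ne h with h | h
    · apply div_le_div_of_nonpos_of_le h.le
      have := Real.rpow_le_rpow_of_nonpos hu huv h.le
      linarith
    · have := Real.rpow_le_rpow hu.le huv h.le
      gcongr

theorem boxCox_le_div {b v : ℝ} (hb : 0 < b) : boxCox b v ≤ v ^ b / b := by
  rw [boxCox, if_neg hb.ne']
  gcongr
  linarith

theorem boxCox_le_of_neg {b v : ℝ} (hb : b < 0) (hv : 0 < v) : boxCox b v ≤ 1 / (-b) := by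
  rw [boxCox, if_neg hb.ne, ← neg_div_neg_eq]
  have : 0 < v ^ b := by positivity
  have : 0 < -b := by linarith
  gcongr
  linarith

theorem log_le_boxCox {b v : ℝ} (hb : 0 ≤ b) (hv : 0 < v) : Real.log v ≤ boxCox b v := by
  rcases hb.eq_or_lt with rfl | hb
  · rw [boxCox_zero]
  · rw [boxCox, if_neg hb.ne', le_div_iff₀ hb, mul_comm, ← Real.log_rpow hv]
    exact Real.log_le_sub_one_of_pos (by positivity)

/-- `R` bounds, at the point `v`, the relative size of the errors that a von Mises rate growing at
most like `x ^ δ` causes in a quantile density with tail index `b` and in its integral. -/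
def WeightBound (δ b v R : ℝ) : Prop :=
  1 + boxCox δ v ≤ R ∧ ∃ c K : ℝ,
    (∀ x, 1 ≤ x → x ≤ v → (1 + boxCox δ x) * x ^ (b - 1) ≤ K * x ^ (c - 1)) ∧
      v ^ (-b) * (1 + K * boxCox c v) ≤ R

theorem WeightBound.mono {δ b v R R' : ℝ} (h : WeightBound δ b v R) (hR : R ≤ R') :
    WeightBound δ b v R' := by
  obtain ⟨h1, c, K, h2, h3⟩ := h
  exact ⟨h1.trans hR, c, K, h2, h3.trans hR⟩

/-! ### Weight bounds according to the sign of the tail index -/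

theorem one_add_log_le_rpow {x p : ℝ} (hx : 1 ≤ x) (hp : 0 < p) :
    1 + Real.log x ≤ (1 + 1 / p) * x ^ p := by
  have h1 := Real.log_le_rpow_div (by linarith : 0 ≤ x) hp
  have h2 := Real.one_le_rpow hx hp.le
  have h3 : (1 + 1 / p) * x ^ p = x ^ p + x ^ p / p := by ring
  linarith

theorem one_add_log_le_mul {s v : ℝ} (hs : 1 ≤ s) (hv : s ≤ v) :
    1 + Real.log v ≤ (1 + Real.log s) * (1 + Real.log (v / s)) := by
  have hs0 : 0 < s := by linarith
  have h1 : Real.log v = Real.log s + Real.log (v / s) := by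
    rw [← Real.log_mul hs0.ne' (div_pos (by linarith) hs0).ne', mul_div_cancel₀ _ hs0.ne']
  have h2 := Real.log_nonneg hs
  have h3 := Real.log_nonneg ((one_le_div hs0).2 hv)
  rw [h1]
  nlinarith

theorem one_add_log_le_mul_rpow {s v : ℝ} (hs : 1 ≤ s) (hv : s ≤ v) :
    1 + Real.log v ≤ 3 * (1 + Real.log s) * (v / s) ^ (3 / 4 : ℝ) := by
  have hs0 : 0 < s := by linarith
  have h2 := Real.log_nonneg hs
  have hvs : 1 ≤ v / s := (one_le_div hs0).2 hv
  have h4 := one_add_log_le_rpow hvs (by norm_num : (0 : ℝ) < 3 / 4)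
  have h5 : 0 < (v / s) ^ (3 / 4 : ℝ) := by positivity
  calc 1 + Real.log v ≤ (1 + Real.log s) * (1 + Real.log (v / s)) := one_add_log_le_mul hs hv
    _ ≤ (1 + Real.log s) * (3 * (v / s) ^ (3 / 4 : ℝ)) := by
      gcongr
      refine h4.trans ?_
      gcongr
      norm_num
    _ = _ := by ring

/-- For `b > 0`, `v ^ (-b) * boxCox b v ≤ 1/b ≤ 2/γ`, so the only growth is the logarithm. It splits
into `log s` and `log (v/s)`, and the latter is absorbed by `(v/s) ^ (3/4)`. -/
theorem weightBound_of_pos {γ b s v : ℝ} (hγ : 0 < γ) (hb : γ / 2 ≤ b) (hs : 1 ≤ s) (hv : s ≤ v) :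
    WeightBound 0 b v (3 * (1 + 2 / γ) * (1 + Real.log s) * (v / s) ^ (3 / 4 : ℝ)) := by
  have hs0 : 0 < s := by linarith
  have hv1 : 1 ≤ v := hs.trans hv
  have hb0 : 0 < b := by linarith
  have hlogv := Real.log_nonneg hv1
  have h1 := one_add_log_le_mul_rpow hs hv
  have h2 : (1 + 2 / γ) * (1 + Real.log v)
      ≤ 3 * (1 + 2 / γ) * (1 + Real.log s) * (v / s) ^ (3 / 4 : ℝ) := by
    calc (1 + 2 / γ) * (1 + Real.log v)
        ≤ (1 + 2 / γ) * (3 * (1 + Real.log s) * (v / s) ^ (3 / 4 : ℝ)) := by gcongr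
      _ = _ := by ring
  have hg : 0 < 2 / γ := by positivity
  refine ⟨?_, b, 1 + Real.log v, ?_, ?_⟩
  · rw [boxCox_zero]
    nlinarith
  · intro x hx hxv
    rw [boxCox_zero]
    have := Real.log_le_log (by linarith) hxv
    gcongr
  · have hvb := Real.one_le_rpow hv1 hb0.le
    have hvb0 : 0 < v ^ b := by positivity
    have h3 : boxCox b v ≤ v ^ b * (2 / γ) := by
      refine (boxCox_le_div hb0).trans ?_
      rw [div_eq_mul_inv]
      gcongr
      rw [← one_div, div_le_div_iff₀ hb0 hγ]
      linarith
    refine le_trans ?_ h2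
    rw [Real.rpow_neg (by linarith), inv_mul_le_iff₀ hvb0]
    calc 1 + (1 + Real.log v) * boxCox b v
        ≤ v ^ b * (1 + Real.log v) + (1 + Real.log v) * (v ^ b * (2 / γ)) := by
          gcongr
          nlinarith
      _ = _ := by ring

theorem rpow_le_exp_mul_rpow {s β B : ℝ} (hs : 1 ≤ s) (α : ℝ) (hβ : |β| * Real.log s ≤ B) :
    s ^ (α + β) ≤ Real.exp B * s ^ α := by
  have hs0 : 0 < s := by linarith
  rw [Real.rpow_add hs0, mul_comm]
  gcongr
  rw [Real.rpow_def_of_pos hs0]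
  apply Real.exp_le_exp.2
  have := Real.log_nonneg hs
  nlinarith [le_abs_self β]

/-- One logarithm comes from the integrand and one from integrating `1/x`, hence `log²`. The
exponent `3/4` is shared: `1/2` for the squared logarithm of `v/s`, `1/4` for `(v/s) ^ (2|b|)`. The
factor `s ^ (2|b|)` is bounded thanks to `B`. -/
theorem weightBound_zero {b s v B : ℝ} (hb : |b| ≤ 1 / 8) (hs : 1 ≤ s) (hv : s ≤ v)
    (hB : |b| * Real.log s ≤ B) :
    WeightBound 0 b v
      (50 * Real.exp (2 * B) * (1 + Real.log s ^ 2) * (v / s) ^ (3 / 4 : ℝ)) := by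
  have hs0 : 0 < s := by linarith
  have hv1 : 1 ≤ v := hs.trans hv
  have hv0 : 0 < v := by linarith
  have hvs : 1 ≤ v / s := (one_le_div hs0).2 hv
  have hlogv := Real.log_nonneg hv1
  have hlogs := Real.log_nonneg hs
  have hlogvs := Real.log_nonneg hvs
  have hb0 := abs_nonneg b
  have hsq : (1 + Real.log v) ^ 2 ≤ 50 * (1 + Real.log s ^ 2) * (v / s) ^ (1 / 2 : ℝ) := by
    have h1 : (1 + Real.log s) ^ 2 ≤ 2 * (1 + Real.log s ^ 2) := by
      nlinarith [sq_nonneg (1 - Real.log s)]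
    have h2 : (1 + Real.log (v / s)) ^ 2 ≤ 25 * (v / s) ^ (1 / 2 : ℝ) := by
      have h3 := one_add_log_le_rpow hvs (by norm_num : (0 : ℝ) < 1 / 4)
      calc (1 + Real.log (v / s)) ^ 2 ≤ ((1 + 1 / (1 / 4)) * (v / s) ^ (1 / 4 : ℝ)) ^ 2 := by
            gcongr
        _ = 25 * (v / s) ^ (1 / 2 : ℝ) := by
            rw [mul_pow, ← Real.rpow_natCast ((v / s) ^ (1 / 4 : ℝ)),
              ← Real.rpow_mul (by positivity)]
            norm_num
    calc (1 + Real.log v) ^ 2 ≤ ((1 + Real.log s) * (1 + Real.log (v / s))) ^ 2 := by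
          gcongr
          exact one_add_log_le_mul hs hv
      _ = (1 + Real.log s) ^ 2 * (1 + Real.log (v / s)) ^ 2 := by ring
      _ ≤ (2 * (1 + Real.log s ^ 2)) * (25 * (v / s) ^ (1 / 2 : ℝ)) := by gcongr
      _ = _ := by ring
  have hpow : v ^ (2 * |b|) ≤ Real.exp (2 * B) * (v / s) ^ (1 / 4 : ℝ) := by
    calc v ^ (2 * |b|) = s ^ (0 + 2 * |b|) * (v / s) ^ (2 * |b|) := by
          rw [zero_add, ← Real.mul_rpow hs0.le (by positivity), mul_div_cancel₀ _ hs0.ne']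
      _ ≤ (Real.exp (2 * B) * s ^ (0 : ℝ)) * (v / s) ^ (1 / 4 : ℝ) := by
          gcongr
          · apply rpow_le_exp_mul_rpow hs
            rw [abs_of_nonneg (by positivity)]; linarith
          · linarith
      _ = _ := by rw [Real.rpow_zero, mul_one]
  have hmain : v ^ (2 * |b|) * (1 + Real.log v) ^ 2
      ≤ 50 * Real.exp (2 * B) * (1 + Real.log s ^ 2) * (v / s) ^ (3 / 4 : ℝ) := by
    calc v ^ (2 * |b|) * (1 + Real.log v) ^ 2
        ≤ (Real.exp (2 * B) * (v / s) ^ (1 / 4 : ℝ)) *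
          (50 * (1 + Real.log s ^ 2) * (v / s) ^ (1 / 2 : ℝ)) := by gcongr
      _ = 50 * Real.exp (2 * B) * (1 + Real.log s ^ 2) *
          ((v / s) ^ (1 / 4 : ℝ) * (v / s) ^ (1 / 2 : ℝ)) := by ring
      _ = _ := by rw [← Real.rpow_add (by positivity)]; norm_num
  have hvb1 : 1 ≤ v ^ |b| := Real.one_le_rpow hv1 hb0
  have hvbb : v ^ (2 * |b|) = v ^ |b| * v ^ |b| := by rw [← Real.rpow_add hv0]; ring_nf
  refine ⟨?_, 0, (1 + Real.log v) * v ^ |b|, ?_, ?_⟩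
  · rw [boxCox_zero]
    refine le_trans ?_ hmain
    rw [hvbb]
    have h1 : 1 ≤ v ^ |b| * v ^ |b| := by nlinarith
    nlinarith [sq_nonneg (1 + Real.log v)]
  · intro x hx hxv
    have hx0 : 0 < x := by linarith
    have h1 := Real.log_le_log hx0 hxv
    have h2 := Real.log_nonneg hx
    rw [boxCox_zero, show b - 1 = b + (0 - 1) by ring, Real.rpow_add hx0, ← mul_assoc]
    have h3 : x ^ b ≤ v ^ |b| := by
      calc x ^ b ≤ x ^ |b| := Real.rpow_le_rpow_of_exponent_le hx (le_abs_self b)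
        _ ≤ v ^ |b| := by gcongr
    gcongr
  · refine le_trans ?_ hmain
    rw [boxCox_zero, hvbb]
    have h3 : v ^ (-b) ≤ v ^ |b| := Real.rpow_le_rpow_of_exponent_le hv1 (neg_le_abs b)
    have h4 : 1 + (1 + Real.log v) * v ^ |b| * Real.log v ≤ v ^ |b| * (1 + Real.log v) ^ 2 := by
      nlinarith [mul_nonneg hlogv (by linarith : 0 ≤ v ^ |b|)]
    have h5 : 0 ≤ (1 + Real.log v) * v ^ |b| * Real.log v := by positivity
    calc v ^ (-b) * (1 + (1 + Real.log v) * v ^ |b| * Real.log v)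
        ≤ v ^ |b| * (v ^ |b| * (1 + Real.log v) ^ 2) := by gcongr
      _ = _ := by ring

/-- The logarithm costs `x ^ (-γ/4)` and `b ≤ γ/2`, so the integrand is `O(x ^ (γ/4 - 1))` and its
integral stays bounded. The growth is that of `v ^ (-b) = s ^ (-b) * (v/s) ^ (-b)`, where `s ^ (γ -
b) ≤ exp B` and `-b ≤ 3/4`. -/
theorem weightBound_of_neg {γ b s v B : ℝ} (hγ : γ < 0) (hb : b ≤ γ / 2) (hb' : -(3 / 4) ≤ b)
    (hs : 1 ≤ s) (hv : s ≤ v) (hB : |b - γ| * Real.log s ≤ B) (hB0 : 0 ≤ B) :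
    WeightBound 0 b v
      (3 * (1 + 4 / (-γ)) ^ 2 * Real.exp B * (1 + s ^ (-γ)) * (v / s) ^ (3 / 4 : ℝ)) := by
  have hs0 : 0 < s := by linarith
  have hv1 : 1 ≤ v := hs.trans hv
  have hv0 : 0 < v := by linarith
  have hvs : 1 ≤ v / s := (one_le_div hs0).2 hv
  have hγ' : 0 < -γ := by linarith
  have hg : 0 < 4 / (-γ) := by positivity
  have hsγ : 1 ≤ s ^ (-γ) := Real.one_le_rpow hs hγ'.le
  have hexp : 1 ≤ Real.exp B := Real.one_le_exp hB0
  set g := 1 + 4 / (-γ) with hgdef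
  have hg1 : 1 ≤ g := by linarith
  refine ⟨?_, γ / 4, g, ?_, ?_⟩
  · rw [boxCox_zero]
    have h1 : 1 + Real.log s ≤ g * s ^ (-γ) := by
      refine (one_add_log_le_rpow hs hγ').trans ?_
      have : 1 / -γ ≤ 4 / -γ := by gcongr; norm_num
      gcongr
      linarith
    calc 1 + Real.log v ≤ 3 * (1 + Real.log s) * (v / s) ^ (3 / 4 : ℝ) :=
          one_add_log_le_mul_rpow hs hv
      _ ≤ 3 * (g ^ 2 * Real.exp B * (1 + s ^ (-γ))) * (v / s) ^ (3 / 4 : ℝ) := by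
          gcongr
          calc 1 + Real.log s ≤ g * s ^ (-γ) := h1
            _ ≤ (g ^ 2 * Real.exp B) * (1 + s ^ (-γ)) := by
              gcongr
              · nlinarith
              · linarith
      _ = _ := by ring
  · intro x hx hxv
    have hx0 : 0 < x := by linarith
    rw [boxCox_zero]
    have h1 := one_add_log_le_rpow hx (by linarith : 0 < -γ / 4)
    have h2 : 1 + 1 / (-γ / 4) = g := by rw [hgdef, one_div_div]
    rw [h2] at h1
    calc (1 + Real.log x) * x ^ (b - 1) ≤ (g * x ^ (-γ / 4)) * x ^ (γ / 2 - 1) := by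
          gcongr
      _ = g * x ^ (γ / 4 - 1) := by
          rw [mul_assoc, ← Real.rpow_add hx0]; congr 2; ring
  · have h1 := boxCox_le_of_neg (by linarith : γ / 4 < 0) hv0
    have h2 : 1 / (-(γ / 4)) = 4 / (-γ) := by rw [← neg_div, one_div_div]
    rw [h2] at h1
    have h3 : 1 + g * boxCox (γ / 4) v ≤ g ^ 2 := by
      have : g * boxCox (γ / 4) v ≤ g * (g - 1) := by gcongr; linarith
      nlinarith
    have h4 : v ^ (-b) ≤ Real.exp B * s ^ (-γ) * (v / s) ^ (3 / 4 : ℝ) := by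
      calc v ^ (-b) = s ^ (-γ + -(b - γ)) * (v / s) ^ (-b) := by
            rw [show -γ + -(b - γ) = -b by ring, ← Real.mul_rpow hs0.le (by positivity),
              mul_div_cancel₀ _ hs0.ne']
        _ ≤ _ := by
            gcongr
            · apply rpow_le_exp_mul_rpow hs
              rwa [abs_neg]
            · linarith
    have h5 : 0 ≤ 1 + g * boxCox (γ / 4) v := by
      have := boxCox_nonneg (γ / 4) hv1
      positivity
    calc v ^ (-b) * (1 + g * boxCox (γ / 4) v)
        ≤ (Real.exp B * s ^ (-γ) * (v / s) ^ (3 / 4 : ℝ)) * g ^ 2 := by gcongr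
      _ = g ^ 2 * Real.exp B * s ^ (-γ) * (v / s) ^ (3 / 4 : ℝ) := by ring
      _ ≤ (3 * g ^ 2) * Real.exp B * (1 + s ^ (-γ)) * (v / s) ^ (3 / 4 : ℝ) := by
          gcongr
          · nlinarith
          · linarith

/-- When `s` stays bounded, powers of `s` are constants, and a rate growing like `x ^ (1/8)` can be
afforded. -/
theorem weightBound_of_le {b s v S : ℝ} (hb : -(1 / 2) ≤ b) (hs : 1 ≤ s) (hv : s ≤ v)
    (hS : s ≤ S) :
    WeightBound (1 / 8) b v (73 * S * (v / s) ^ (3 / 4 : ℝ)) := by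
  have hs0 : 0 < s := by linarith
  have hv1 : 1 ≤ v := hs.trans hv
  have hv0 : 0 < v := by linarith
  have hvs : 1 ≤ v / s := (one_le_div hs0).2 hv
  have hvS : v ^ (3 / 4 : ℝ) ≤ S * (v / s) ^ (3 / 4 : ℝ) := by
    calc v ^ (3 / 4 : ℝ) = s ^ (3 / 4 : ℝ) * (v / s) ^ (3 / 4 : ℝ) := by
          rw [← Real.mul_rpow hs0.le (by positivity), mul_div_cancel₀ _ hs0.ne']
      _ ≤ S * (v / s) ^ (3 / 4 : ℝ) := by
          gcongr
          calc s ^ (3 / 4 : ℝ) ≤ s ^ (1 : ℝ) := Real.rpow_le_rpow_of_exponent_le hs (by norm_num)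
            _ ≤ S := by rwa [Real.rpow_one]
  have hone : ∀ x : ℝ, 1 ≤ x → 1 + boxCox (1 / 8) x ≤ 9 * x ^ (1 / 8 : ℝ) := by
    intro x hx
    have h1 := boxCox_le_div (b := 1 / 8) (v := x) (by norm_num)
    have h2 := Real.one_le_rpow hx (by norm_num : (0 : ℝ) ≤ 1 / 8)
    linarith
  -- The maximum keeps `c` away from `0`, so `boxCox c v ≤ 8 * v ^ c`; `b ≥ -1/2` then gives `c - b
  -- ≤ 5/8` or `1/8`.
  set c := max (b + 1 / 8) (1 / 8) with hc
  have hc8 : 1 / 8 ≤ c := le_max_right _ _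
  have hcb : b + 1 / 8 ≤ c := le_max_left _ _
  have hcb2 : c - b ≤ 3 / 4 := by
    rcases max_choice (b + 1 / 8) (1 / 8) with h | h <;> rw [hc, h] <;> linarith
  refine ⟨?_, c, 9, ?_, ?_⟩
  · calc 1 + boxCox (1 / 8) v ≤ 9 * v ^ (1 / 8 : ℝ) := hone v hv1
      _ ≤ 73 * v ^ (3 / 4 : ℝ) := by
          have := Real.rpow_le_rpow_of_exponent_le hv1 (by norm_num : (1 / 8 : ℝ) ≤ 3 / 4)
          linarith [Real.rpow_nonneg hv0.le (3 / 4 : ℝ)]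
      _ ≤ 73 * (S * (v / s) ^ (3 / 4 : ℝ)) := by gcongr
      _ = _ := by ring
  · intro x hx hxv
    have hx0 : 0 < x := by linarith
    calc (1 + boxCox (1 / 8) x) * x ^ (b - 1) ≤ 9 * x ^ (1 / 8 : ℝ) * x ^ (b - 1) := by
          gcongr
          exact hone x hx
      _ = 9 * x ^ (b + 1 / 8 - 1) := by
          rw [mul_assoc, ← Real.rpow_add hx0]; congr 2; ring
      _ ≤ 9 * x ^ (c - 1) := by
          gcongr
  · have h1 : boxCox c v ≤ 8 * v ^ c := by
      refine (boxCox_le_div (by linarith)).trans ?_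
      rw [div_le_iff₀ (by linarith)]
      have : 0 < v ^ c := by positivity
      nlinarith
    have h2 : 1 ≤ v ^ c := Real.one_le_rpow hv1 (by linarith)
    calc v ^ (-b) * (1 + 9 * boxCox c v) ≤ v ^ (-b) * (73 * v ^ c) := by
          gcongr
          linarith
      _ = 73 * v ^ (c - b) := by
          rw [mul_left_comm, ← Real.rpow_add hv0]; congr 2; ring
      _ ≤ 73 * v ^ (3 / 4 : ℝ) := by
          gcongr
      _ ≤ 73 * (S * (v / s) ^ (3 / 4 : ℝ)) := by gcongr
      _ = _ := by ring

/-- The deterministic core. The logarithm of the ratio of the two quantile derivatives is the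
increment of `L`, plus `(γ - b) log v`, minus `log (σ/a₀)`, hence `O(e (1 + boxCox δ v))`.
Integrating from the intermediate level `v = 1`, where the initial error is `(U t - T)/σ`, compares
the quantile functions themselves. -/
theorem hellinger_predictiveDensity_le {μ : Measure ℝ} [IsProbabilityMeasure μ] {A L : ℝ → ℝ}
    {γ x₁ t s b σ T e δ Γ W : ℝ} (h : TailRepresentation (cdf μ) A L γ x₁) (ht : x₁ < t)
    (hs : 1 ≤ s) (hδ : 0 ≤ δ) (he0 : 0 < e) (he : e ≤ 1 / 2) (hb : |b - γ| ≤ e)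
    (hσ : |σ / (t ^ γ * Real.exp (L t)) - 1| ≤ e)
    (hT : |(T - tailQuantile (cdf μ) t) / (t ^ γ * Real.exp (L t))| ≤ e)
    (hA : ∀ x, 1 ≤ x → |A (t * x)| ≤ e * x ^ δ) (hΓ : 1 ≤ Γ) (hbΓ : |b| ≤ Γ) (hW0 : 0 < W)
    (hW : ∀ v, s ≤ v → WeightBound δ b v (W * (v / s) ^ (3 / 4 : ℝ))) :
    hellinger (predictiveDensity μ (tailQuantile (cdf μ) (t * s)))
      (gpPredictiveDensity b σ (1 / s) T) ≤ Real.sqrt (200 * Γ * (4 * e * W)) := by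
  have hx₁ := h.one_lt
  have ht0 : 0 < t := by linarith
  have hs0 : 0 < s := by linarith
  set a₀ := t ^ γ * Real.exp (L t) with ha₀
  have ha₀0 : 0 < a₀ := by positivity
  have hσ' := abs_le.1 hσ
  have hσa : 1 / 2 ≤ σ / a₀ := by linarith
  have hσ0 : 0 < σ := by
    rw [le_div_iff₀ ha₀0] at hσa; linarith
  set G : ℝ → ℝ := fun v => tailQuantile (cdf μ) (t * v) with hG
  set G' : ℝ → ℝ := fun v => a₀ * (v ^ (γ - 1) * Real.exp (L (t * v) - L t)) with hG'
  have hlogE : ∀ v, 1 ≤ v → ∃ y, G' v * v ^ (1 - b) / σ = Real.exp y ∧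
      |y| ≤ 2 * e * (1 + boxCox δ v) := by
    intro v hv
    have hv0 : 0 < v := by linarith
    refine ⟨L (t * v) - L t + (γ - b) * Real.log v - Real.log (σ / a₀), ?_, ?_⟩
    · rw [Real.exp_sub, Real.exp_add, Real.exp_log (by positivity), mul_comm (γ - b),
        ← Real.rpow_def_of_pos hv0, hG', show γ - b = γ - 1 + (1 - b) by ring,
        Real.rpow_add hv0]
      field_simp
    · have h1 := h.abs_log_sub_le ht hv hA
      have h2 : |Real.log (σ / a₀)| ≤ 2 * e := by
        have h3 := abs_log_one_add_le (hσ.trans he)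
        rw [add_sub_cancel] at h3
        linarith
      have h3 : |(γ - b) * Real.log v| ≤ e * boxCox δ v := by
        rw [abs_mul, abs_sub_comm, abs_of_nonneg (Real.log_nonneg hv)]
        have h4 := log_le_boxCox hδ hv0
        have h5 := Real.log_nonneg hv
        gcongr
      calc |L (t * v) - L t + (γ - b) * Real.log v - Real.log (σ / a₀)|
          ≤ |L (t * v) - L t| + |(γ - b) * Real.log v| + |Real.log (σ / a₀)| :=
            (abs_sub _ _).trans (by gcongr; exact abs_add_le _ _)
        _ ≤ e * boxCox δ v + e * boxCox δ v + 2 * e := by gcongr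
        _ = 2 * e * (1 + boxCox δ v) := by ring
  have hE : ∀ v, 1 ≤ v → 2 * e * (1 + boxCox δ v) ≤ 1 →
      |G' v * v ^ (1 - b) / σ - 1| ≤ 4 * e * (1 + boxCox δ v) := by
    intro v hv hsmall
    obtain ⟨y, hy, hy2⟩ := hlogE v hv
    rw [hy]
    have := Real.abs_exp_sub_one_le (hy2.trans hsmall)
    linarith
  have hsmall : ∀ v, s < v → 4 * e * W * (v / s) ^ (3 / 4 : ℝ) ≤ 1 / 16 →
      2 * e * (1 + boxCox δ v) ≤ 1 := by
    intro v hv hκ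
    have h1 := (hW v hv.le).1
    have h2 : 2 * e * (1 + boxCox δ v) ≤ 2 * e * (W * (v / s) ^ (3 / 4 : ℝ)) := by gcongr
    linarith
  refine hellinger_gpPredictiveDensity_le (h.isParetoImage ht0 hs0 (by nlinarith)) hσ0 hs0 hΓ hbΓ
    (by positivity) ?_ ?_
  · intro v hv hκ
    refine (hE v (by linarith) (hsmall v hv hκ)).trans ?_
    rw [mul_assoc (4 * e)]
    gcongr
    exact (hW v hv.le).1
  · intro v hv hκ
    have hv1 : 1 ≤ v := by linarith
    have hv0 : 0 < v := by linarith
    obtain ⟨-, c, K, hK, hfin⟩ := hW v hv.le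
    have h1 := abs_sub_le_mul_boxCox (b := c) (K := 4 * e * K)
      (f := fun x => (G x - T) / σ - boxCox b x)
      (f' := fun x => x ^ (b - 1) * (G' x * x ^ (1 - b) / σ - 1)) hv1
      (fun x hx _ => ?_) (fun x hx hxv => ?_)
    · have h2 : |(G 1 - T) / σ - boxCox b 1| ≤ 4 * e := by
        rw [boxCox_one, sub_zero, hG]
        simp only [mul_one]
        rw [abs_div, abs_of_pos ha₀0, div_le_iff₀ ha₀0] at hT
        rw [abs_div, abs_of_pos hσ0, div_le_iff₀ hσ0, abs_sub_comm]
        rw [le_div_iff₀ ha₀0] at hσa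
        nlinarith
      have h3 : |(G v - T) / σ - boxCox b v| ≤ 4 * e * (1 + K * boxCox c v) := by
        have := abs_sub_abs_le_abs_sub ((G v - T) / σ - boxCox b v) ((G 1 - T) / σ - boxCox b 1)
        nlinarith
      rw [abs_mul, abs_of_pos (Real.rpow_pos_of_pos hv0 _)]
      calc v ^ (-b) * |(G v - T) / σ - boxCox b v|
          ≤ v ^ (-b) * (4 * e * (1 + K * boxCox c v)) := by gcongr
        _ = 4 * e * (v ^ (-b) * (1 + K * boxCox c v)) := by ring
        _ ≤ 4 * e * (W * (v / s) ^ (3 / 4 : ℝ)) := by gcongr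
        _ = _ := by ring
    · have hx0 : 0 < x := by linarith
      refine (((h.hasDerivAt_comp_mul ht0 hx0 (by nlinarith)).sub_const T).div_const σ).sub
        (hasDerivAt_boxCox b hx0) |>.congr_deriv ?_
      have h2 : x ^ (b - 1) * x ^ (1 - b) = 1 := by
        rw [← Real.rpow_add hx0]; norm_num
      change G' x / σ - x ^ (b - 1) = _
      linear_combination -(G' x / σ) * h2
    · have hx0 : 0 < x := by linarith
      have hmono := boxCox_mono δ hx0 hxv
      have h2 := hE x hx (le_trans (by gcongr) (hsmall v hv hκ))
      rw [abs_mul, abs_of_pos (Real.rpow_pos_of_pos hx0 _)]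
      calc x ^ (b - 1) * |G' x * x ^ (1 - b) / σ - 1|
          ≤ x ^ (b - 1) * (4 * e * (1 + boxCox δ x)) := by gcongr
        _ = 4 * e * ((1 + boxCox δ x) * x ^ (b - 1)) := by ring
        _ ≤ 4 * e * (K * x ^ (c - 1)) := by
          exact mul_le_mul_of_nonneg_left (hK x hx hxv) (by positivity)
        _ = _ := by ring

/-! ### Rates -/

theorem w_nonneg (γ : ℝ) {s : ℝ} (hs : 1 ≤ s) : 0 ≤ w γ s := by
  unfold w
  split_ifs
  · exact Real.log_nonneg hs
  · positivity
  · exact Real.rpow_nonneg (by linarith) _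

/-- The assumption `η * w → 0` keeps `|b - γ| * log s` bounded when `γ ≤ 0`, so replacing `γ` by its
estimate in powers of `s` costs only a constant. -/
theorem eventually_weightBound_zero {γ M : ℝ} {s η : ℕ → ℝ} (hγ : -(1 / 2) < γ)
    (hs : ∀ᶠ n in atTop, 1 ≤ s n) (hη : Tendsto η atTop (𝓝 0))
    (hη0 : ∀ᶠ n in atTop, 0 ≤ η n) (hηw : Tendsto (fun n => η n * w γ (s n)) atTop (𝓝 0))
    (hM : 0 < M) :
    ∃ N : ℝ, 0 < N ∧ ∀ᶠ n in atTop, ∀ b, |b - γ| ≤ M * η n → ∀ v, s n ≤ v →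
      WeightBound 0 b v (N * (1 + w γ (s n)) * (v / s n) ^ (3 / 4 : ℝ)) := by
  have hsmall : ∀ c : ℝ, 0 < c → ∀ᶠ n in atTop, M * η n ≤ c := fun c hc => by
    have := hη.const_mul M
    rw [mul_zero] at this
    exact this.eventually_le_const hc
  rcases lt_trichotomy γ 0 with hneg | hzero | hpos
  · have hγ' : 0 < -γ := by linarith
    refine ⟨3 * (1 + 4 / (-γ)) ^ 2 * Real.exp (M / (-γ)), by positivity, ?_⟩
    filter_upwards [hs, hη0, hηw.eventually_le_const one_pos,
      hsmall (min (-γ / 2) (1 / 4)) (by positivity)] with n hs1 hη1 hw1 hMη b hb v hv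
    have hw : w γ (s n) = s n ^ (-γ) := by
      unfold w; rw [if_neg (by linarith), if_neg hneg.ne]
    rw [hw] at hw1 ⊢
    have hb' := abs_le.1 (hb.trans hMη)
    have h1 := min_le_left (-γ / 2) (1 / 4)
    have h2 := min_le_right (-γ / 2) (1 / 4)
    refine weightBound_of_neg hneg (by linarith) (by linarith) hs1 hv ?_ (by positivity)
    have h3 := Real.log_le_rpow_div (by linarith : 0 ≤ s n) hγ'
    have h4 := Real.log_nonneg hs1
    calc |b - γ| * Real.log (s n) ≤ (M * η n) * (s n ^ (-γ) / -γ) := by gcongr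
      _ = M * (η n * s n ^ (-γ)) / -γ := by ring
      _ ≤ M * 1 / -γ := by gcongr
      _ = M / -γ := by ring
  · subst hzero
    refine ⟨50 * Real.exp (2 * (2 * M)), by positivity, ?_⟩
    filter_upwards [hs, hη0, hηw.eventually_le_const one_pos, hη.eventually_le_const one_pos,
      hsmall (1 / 8) (by norm_num)] with n hs1 hη1 hw1 hη2 hMη b hb v hv
    have hw : w 0 (s n) = Real.log (s n) ^ 2 := by simp [w]
    rw [hw] at hw1 ⊢
    rw [sub_zero] at hb
    refine weightBound_zero (hb.trans hMη) hs1 hv ?_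
    have h4 := Real.log_nonneg hs1
    have h5 : Real.log (s n) ≤ 1 + Real.log (s n) ^ 2 := by nlinarith [sq_nonneg (Real.log (s n) - 1)]
    calc |b| * Real.log (s n) ≤ (M * η n) * (1 + Real.log (s n) ^ 2) := by gcongr
      _ = M * (η n + η n * Real.log (s n) ^ 2) := by ring
      _ ≤ M * (1 + 1) := by gcongr
      _ = 2 * M := by ring
  · refine ⟨3 * (1 + 2 / γ), by positivity, ?_⟩
    filter_upwards [hs, hsmall (γ / 2) (by positivity)] with n hs1 hMη b hb v hv
    have hw : w γ (s n) = Real.log (s n) := by simp [w, hpos]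
    rw [hw]
    have hb' := abs_le.1 (hb.trans hMη)
    exact weightBound_of_pos hpos (by linarith) hs1 hv

theorem eventually_weightBound_of_le {γ M S : ℝ} {s η : ℕ → ℝ} (hγ : -(1 / 2) < γ)
    (hs : ∀ᶠ n in atTop, 1 ≤ s n) (hS : ∀ᶠ n in atTop, s n ≤ S) (hη : Tendsto η atTop (𝓝 0)) :
    ∃ N : ℝ, 0 < N ∧ ∀ᶠ n in atTop, ∀ b, |b - γ| ≤ M * η n → ∀ v, s n ≤ v →
      WeightBound (1 / 8) b v (N * (1 + w γ (s n)) * (v / s n) ^ (3 / 4 : ℝ)) := by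
  have hS1 : 1 ≤ S := by
    obtain ⟨n, h1, h2⟩ := (hs.and hS).exists
    linarith
  have h0 := hη.const_mul M
  rw [mul_zero] at h0
  refine ⟨73 * S, by positivity, ?_⟩
  filter_upwards [hs, hS, h0.eventually_le_const (by linarith : 0 < γ + 1 / 2)]
    with n hs1 hS1' hMη b hb v hv
  have hb' := abs_le.1 (hb.trans hMη)
  refine (weightBound_of_le (by linarith) hs1 hv hS1').mono ?_
  have h1 := w_nonneg γ hs1
  have h2 : 0 < v / s n := div_pos (by linarith) (by linarith)
  have h3 : 73 * S ≤ 73 * S * (1 + w γ (s n)) := le_mul_of_one_le_right (by positivity) (by linarith)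
  gcongr

/-- If `w` is bounded below, `1 + w` is of order `w` and `η ≤ ε` finishes. This fails only for `γ ≥
0`, `τ₀ = 1`; there `w ≤ 1` eventually, and `hdeg` bounds `η` itself by a multiple of `ε * w`. -/
theorem exists_mul_one_add_w_le {γ τ₀ : ℝ} {τ ε η : ℕ → ℝ} (hτ : Tendsto τ atTop (𝓝 τ₀))
    (hτ1 : ∀ᶠ n in atTop, 0 < τ n ∧ τ n ≤ 1) (hη0 : ∀ᶠ n in atTop, 0 ≤ η n)
    (hε0 : ∀ n, 0 < ε n) (hηε : ∀ᶠ n in atTop, η n ≤ ε n)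
    (hdeg : 0 ≤ γ → τ₀ = 1 → η =O[atTop] fun n => ε n * w γ (1 / τ n)) :
    ∃ C : ℝ, 0 < C ∧ ∀ᶠ n in atTop, η n * (1 + w γ (1 / τ n)) ≤ C * (ε n * w γ (1 / τ n)) := by
  have hs1 : ∀ᶠ n in atTop, 1 ≤ 1 / τ n := by
    filter_upwards [hτ1] with n hn
    rw [le_div_iff₀ hn.1]; linarith
  have key : ∀ m : ℝ, 0 < m → (∀ᶠ n in atTop, m ≤ w γ (1 / τ n)) →
      ∃ C : ℝ, 0 < C ∧ ∀ᶠ n in atTop, η n * (1 + w γ (1 / τ n)) ≤ C * (ε n * w γ (1 / τ n)) := by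
    intro m hm hw
    refine ⟨1 / m + 1, by positivity, ?_⟩
    filter_upwards [hw, hη0, hηε] with n hn h0 h1
    have h2 : 1 ≤ 1 / m * w γ (1 / τ n) := by
      rw [one_div_mul_eq_div, le_div_iff₀ hm]; linarith
    have h3 := hε0 n
    calc η n * (1 + w γ (1 / τ n)) ≤ ε n * (1 / m * w γ (1 / τ n) + w γ (1 / τ n)) := by
          gcongr
          linarith
      _ = _ := by ring
  by_cases hγ : 0 ≤ γ
  · by_cases h1 : τ₀ = 1
    · obtain ⟨c, hc, hO⟩ := (hdeg hγ h1).exists_pos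
      rw [IsBigOWith] at hO
      refine ⟨2 * c, by positivity, ?_⟩
      have hlog : Tendsto (fun n => Real.log (1 / τ n)) atTop (𝓝 0) := by
        have h2 : Tendsto (fun n => 1 / τ n) atTop (𝓝 1) := by
          have := hτ.inv₀ (by rw [h1]; exact one_ne_zero)
          simpa [h1, one_div] using this
        have h3 := (Real.continuousAt_log one_ne_zero).tendsto.comp h2
        rwa [Real.log_one] at h3
      filter_upwards [hO, hs1, hη0, hlog.eventually_le_const one_pos] with n hn hsn h0 hl
      have hwn := w_nonneg γ hsn
      have hεn := hε0 n
      have hw1 : w γ (1 / τ n) ≤ 1 := by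
        have h4 := Real.log_nonneg hsn
        unfold w
        split_ifs with h5 h6
        · exact hl
        · nlinarith
        · exact absurd (lt_of_le_of_ne hγ (Ne.symm h6)) h5
      rw [Real.norm_of_nonneg h0, Real.norm_of_nonneg (by positivity)] at hn
      nlinarith
    · have hτ01 : τ₀ ≤ 1 := le_of_tendsto hτ (hτ1.mono fun n hn => hn.2)
      have hτ0 : 0 ≤ τ₀ := ge_of_tendsto hτ (hτ1.mono fun n hn => hn.1.le)
      have hlt : τ₀ < 1 := lt_of_le_of_ne hτ01 h1
      set q := (1 + τ₀) / 2 with hq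
      have hq1 : τ₀ < q := by linarith
      have hq2 : q < 1 := by linarith
      have hq0 : 0 < q := by linarith
      set m := Real.log (1 / q) with hm
      have hm0 : 0 < m := Real.log_pos (by rw [lt_div_iff₀ hq0]; linarith)
      refine key (min m (m ^ 2)) (by positivity) ?_
      filter_upwards [hτ1, hτ.eventually_le_const hq1] with n hn hqn
      have h3 : m ≤ Real.log (1 / τ n) := by
        apply Real.log_le_log (by positivity)
        exact one_div_le_one_div_of_le hn.1 hqn
      unfold w
      split_ifs with h5 h6
      · exact (min_le_left _ _).trans h3
      · exact (min_le_right _ _).trans (by gcongr)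
      · exact absurd (lt_of_le_of_ne hγ (Ne.symm h6)) h5
  · have hγ' : γ < 0 := not_le.1 hγ
    refine key 1 one_pos ?_
    filter_upwards [hs1] with n hn
    unfold w
    rw [if_neg (by linarith), if_neg hγ'.ne]
    exact Real.one_le_rpow hn (by linarith)

end ExtremePred

/-! ### Assembly of the main theorem -/

open ExtremePred in
theorem mainTheorem3
    {Ω : Type*} [MeasurableSpace Ω] (P : Measure Ω) [IsProbabilityMeasure P]
    -- the iid sample, with common law `μ` and distribution function `cdf μ`
    (μ : Measure ℝ) [IsProbabilityMeasure μ]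
    (X : ℕ → Ω → ℝ) (hXmeas : ∀ i, Measurable (X i)) (hXindep : iIndepFun X P)
    (hXlaw : ∀ i, P.map (X i) = μ)
    -- the second-order von Mises condition, with scaling function `a` and rate function `A`
    (a A : ℝ → ℝ) (γ ρ : ℝ) (ha : ∀ᶠ t in atTop, 0 < a t)
    (hA : A = vonMisesRate (quantile (cdf μ)) γ)
    (hSO : VonMisesCondition (cdf μ) a γ ρ) (hγ : -(1 / 2) < γ)
    -- effective sample size `k` and intermediate level `1 - k / n`
    (k : ℕ → ℕ) (hk : Tendsto k atTop atTop)
    (hkn : Tendsto (fun n : ℕ => (k n : ℝ) / n) atTop (𝓝 0))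
    -- extreme level `1 - ν / n`, and ratio `τ = (1 - τ_E) / (1 - τ_I)`
    (ν : ℕ → ℝ) (hν : ∀ᶠ n in atTop, 0 < ν n ∧ ν n ≤ k n)
    (τI τE τ : ℕ → ℝ) (hτI : ∀ n, τI n = 1 - k n / n) (hτE : ∀ n, τE n = 1 - ν n / n)
    (hτ : ∀ n, τ n = (1 - τE n) / (1 - τI n))
    (τ₀ : ℝ) (hτ₀ : Tendsto τ atTop (𝓝 τ₀))
    (hmono : ρ = 0 → τ₀ = 0 → ∃ T : ℝ, AntitoneOn (fun t => |A t|) (Set.Ici T))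
    (hAw : Tendsto (fun n : ℕ => A ((n : ℝ) / k n) * w γ (1 / τ n)) atTop (𝓝 0))
    -- estimators of the tail index and of the scale
    (T₁ T₂ : (n : ℕ) → (Fin (k n + 1) → ℝ) → ℝ)
    (hT₁ : ∀ n, Measurable (T₁ n)) (hT₂ : ∀ n, Measurable (T₂ n))
    (γhat σhat : ℕ → Ω → ℝ)
    (hγhat : ∀ n ω, γhat n ω = T₁ n (topOrderStats n (k n) (fun i => X i ω)))
    (hσhat : ∀ n ω, σhat n ω = T₂ n (topOrderStats n (k n) (fun i => X i ω)))
    (hγcons : IsBigOP P (fun n ω => |γhat n ω - γ|) (fun n => 1 / Real.sqrt (k n)))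
    (hσcons : IsBigOP P (fun n ω => |σhat n ω / a ((n : ℝ) / k n) - 1|)
      (fun n => 1 / Real.sqrt (k n)))
    (l : ℝ) (hl : 0 < l)
    (hbal : Tendsto (fun n : ℕ => Real.sqrt (k n) * |A ((n : ℝ) / k n)|) atTop (𝓝 l)) :
    ∀ ε : ℕ → ℝ, (∀ n, 0 < ε n) → Tendsto ε atTop (𝓝 0) →
      Tendsto (fun n => (k n : ℝ) * ε n ^ 2) atTop atTop →
      Tendsto (fun n => ε n * w γ (1 / τ n)) atTop (𝓝 0) →
      -- only needed in the degenerate case, where `w γ (1 / τ n)` tends to `0`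
      (0 ≤ γ → τ₀ = 1 →
        (fun n => 1 / Real.sqrt (k n)) =O[atTop] (fun n => ε n * w γ (1 / τ n))) →
      IsBigOP P
        (fun n ω => hellinger
          (predictiveDensity μ (quantile (cdf μ) (τE n)))
          (gpPredictiveDensity (γhat n ω) (σhat n ω) (τ n)
            (orderStat n (fun i => X i ω) (n - k n))))
        (fun n => Real.sqrt (ε n * w γ (1 / τ n))) := by
  subst hA
  set A := vonMisesRate (quantile (cdf μ)) γ with hAdef
  obtain ⟨x₁, L, hrep⟩ := hSO.exists_tailRepresentation
  rw [← hAdef] at hrep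
  have hS : SecondOrder (quantile (cdf μ)) a A γ ρ := hSO.2.2
  have hA0 : Tendsto A atTop (𝓝 0) := hS.2.1
  have hRV := hS.2.2.1
  intro ε hε0 hε hkε hεw hdeg
  have hk1 : ∀ᶠ n in atTop, 1 ≤ k n := hk.eventually_ge_atTop 1
  set t : ℕ → ℝ := fun n => (n : ℝ) / k n with htdef
  have ht : Tendsto t atTop atTop := by
    have h1 : Tendsto (fun n : ℕ => (k n : ℝ) / n) atTop (𝓝[>] 0) := by
      refine tendsto_nhdsWithin_iff.2 ⟨hkn, ?_⟩
      filter_upwards [hk1, eventually_ge_atTop 1] with n h1 h2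
      have h3 : (0 : ℝ) < k n := by exact_mod_cast h1
      have h4 : (0 : ℝ) < n := by exact_mod_cast h2
      exact div_pos h3 h4
    refine h1.inv_tendsto_nhdsGT_zero.congr fun n => ?_
    simp [htdef]
  set η : ℕ → ℝ := fun n => 1 / Real.sqrt (k n) with hηdef
  have hsqrt : Tendsto (fun n => Real.sqrt (k n)) atTop atTop :=
    Real.tendsto_sqrt_atTop.comp (tendsto_natCast_atTop_atTop.comp hk)
  have hη : Tendsto η atTop (𝓝 0) := by
    exact hsqrt.inv_tendsto_atTop.congr fun n => by simp [hηdef]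
  have hη0 : ∀ᶠ n in atTop, 0 < η n := by
    filter_upwards [hsqrt.eventually_gt_atTop 0] with n hn
    exact one_div_pos.2 hn
  have hτeq : ∀ᶠ n in atTop, τ n = ν n / k n ∧ 0 < τ n ∧ τ n ≤ 1 ∧
      τE n = 1 - 1 / (t n * (1 / τ n)) := by
    filter_upwards [hk1, eventually_ge_atTop 1, hν] with n h1 h2 h3
    have h4 : (0 : ℝ) < k n := by exact_mod_cast h1
    have h5 : (0 : ℝ) < n := by exact_mod_cast h2
    have h6 : τ n = ν n / k n := by
      rw [hτ, hτE, hτI, sub_sub_cancel, sub_sub_cancel, div_div_div_cancel_right₀ h5.ne']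
    refine ⟨h6, ?_, ?_, ?_⟩
    · rw [h6]; exact div_pos h3.1 h4
    · rw [h6, div_le_one h4]; exact h3.2
    · have h7 := h3.1.ne'
      rw [hτE, h6, htdef]; field_simp
  have hτ1 : ∀ᶠ n in atTop, 0 < τ n ∧ τ n ≤ 1 := hτeq.mono fun n h => ⟨h.2.1, h.2.2.1⟩
  have hs1 : ∀ᶠ n in atTop, 1 ≤ 1 / τ n := by
    filter_upwards [hτ1] with n hn
    rw [le_div_iff₀ hn.1]; linarith [hn.2]
  have hAη : ∀ᶠ n in atTop, l / 2 * η n ≤ |A (t n)| ∧ |A (t n)| ≤ 2 * l * η n := by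
    filter_upwards [hbal.eventually_const_le (by linarith : l / 2 < l),
      hbal.eventually_le_const (by linarith : l < 2 * l), hsqrt.eventually_gt_atTop 0]
      with n h1 h2 h3
    constructor
    · rw [hηdef, mul_one_div, div_le_iff₀ h3]; linarith
    · rw [hηdef, mul_one_div, le_div_iff₀ h3]; linarith
  -- Positivity of the limit `l` makes `η` at most a multiple of `|A (t n)|`, which transfers `hAw`
  -- to `η`.
  have hηw : Tendsto (fun n => η n * w γ (1 / τ n)) atTop (𝓝 0) := by
    have h1 : Tendsto (fun n => 2 / l * |A (t n) * w γ (1 / τ n)|) atTop (𝓝 0) := by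
      have := (hAw.abs).const_mul (2 / l)
      simpa using this
    refine squeeze_zero' ?_ ?_ h1
    · filter_upwards [hη0, hs1] with n h2 h3
      exact mul_nonneg h2.le (w_nonneg γ h3)
    · filter_upwards [hAη, hs1] with n h2 h3
      have h4 := w_nonneg γ h3
      rw [abs_mul, abs_of_nonneg h4, ← mul_assoc]
      gcongr
      calc η n = 2 / l * (l / 2 * η n) := by field_simp
        _ ≤ 2 / l * |A (t n)| := by gcongr; exact h2.1
  -- For `ρ < 0`, or when `|A|` is eventually nonincreasing, `δ = 0` works. For `ρ = 0` with `τ₀ >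
  -- 0` only a Potter bound with `δ > 0` is available, but then `1/τ n` stays bounded.
  obtain ⟨δ, hδ0, ⟨C₁, T₁', hC₁, hgrow⟩, hweight⟩ : ∃ δ : ℝ, 0 ≤ δ ∧
      (∃ C T : ℝ, 0 < C ∧ ∀ t, T ≤ t → ∀ x, 1 ≤ x → |A (t * x)| ≤ C * x ^ δ * |A t|) ∧
      ∀ M : ℝ, 0 < M → ∃ N : ℝ, 0 < N ∧ ∀ᶠ n in atTop, ∀ b, |b - γ| ≤ M * η n →
        ∀ v, 1 / τ n ≤ v →
        WeightBound δ b v (N * (1 + w γ (1 / τ n)) * (v / (1 / τ n)) ^ (3 / 4 : ℝ)) := by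
    by_cases hcase : ρ = 0 ∧ τ₀ ≠ 0
    · refine ⟨1 / 8, by norm_num, hRV.exists_le_mul_rpow hS.1 (by norm_num)
        (by rw [hcase.1]; norm_num), fun M hM => ?_⟩
      have hlim : Tendsto (fun n => 1 / τ n) atTop (𝓝 (1 / τ₀)) := by
        simpa [one_div] using hτ₀.inv₀ hcase.2
      exact eventually_weightBound_of_le hγ hs1 (hlim.eventually_le_const (lt_add_one _)) hη
    · refine ⟨0, le_rfl, ?_, fun M hM => eventually_weightBound_zero hγ hs1 hη
        (hη0.mono fun n h => h.le) hηw hM⟩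
      rcases hS.1.lt_or_eq with h1 | h1
      · exact hRV.exists_le_mul_rpow hS.1 le_rfl h1
      · obtain ⟨T, hT⟩ := hmono h1 (by by_contra h2; exact hcase ⟨h1, h2⟩)
        refine ⟨1, max T 0, one_pos, fun t ht x hx => ?_⟩
        have h2 : T ≤ t := (le_max_left _ _).trans ht
        have h3 : t ≤ t * x := le_mul_of_one_le_right ((le_max_right _ _).trans ht) hx
        rw [Real.rpow_zero, one_mul, one_mul]
        exact hT h2 (h2.trans h3) h3
  obtain ⟨Ca, Ta, hCa, hscale⟩ := hrep.exists_abs_div_sub_one_le ha hS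
  have hηε : ∀ᶠ n in atTop, η n ≤ ε n := by
    filter_upwards [hkε.eventually_ge_atTop 1, hk1, hsqrt.eventually_gt_atTop 0] with n h1 h2 h3
    have h4 : Real.sqrt (k n) ^ 2 = k n := Real.sq_sqrt (Nat.cast_nonneg _)
    rw [hηdef, div_le_iff₀ h3]
    have h5 : 1 ≤ (ε n * Real.sqrt (k n)) ^ 2 := by rw [mul_pow, h4]; linarith
    have h6 : 0 < ε n * Real.sqrt (k n) := mul_pos (hε0 n) h3
    nlinarith
  obtain ⟨C₂, hC₂, hrate⟩ := exists_mul_one_add_w_le (γ := γ) hτ₀ hτ1 (hη0.mono fun n h => h.le)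
    hε0 hηε hdeg
  intro δ' hδ'
  have hδ3 : 0 < δ' / 3 := by positivity
  obtain ⟨M₁, hM₁, hγev⟩ := hγcons _ hδ3
  obtain ⟨M₂, hM₂, hσev⟩ := hσcons _ hδ3
  obtain ⟨M₃, hM₃, hTev⟩ := isBigOP_orderStat_sub hXmeas hXindep hXlaw hrep hA0 hk ht _ hδ3
  obtain ⟨N, hN, hWev⟩ := hweight M₁ hM₁
  -- In order: tail index, scale (measured in `a₀` instead of `a`), order statistic, and von Mises
  -- rate.
  set M := M₁ + (2 * M₂ + 2 * Ca * l) + M₃ + 2 * C₁ * l with hMdef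
  have hM : 0 < M := by positivity
  have hMη : ∀ c : ℝ, 0 < c → ∀ M : ℝ, ∀ᶠ n in atTop, M * η n ≤ c := fun c hc M => by
    have h0 := hη.const_mul M
    rw [mul_zero] at h0
    exact h0.eventually_le_const hc
  set Γ := |γ| + 1 with hΓdef
  have hΓ1 : 1 ≤ Γ := by have := abs_nonneg γ; linarith
  refine ⟨Real.sqrt (200 * Γ * (4 * M * N * C₂)), by positivity, ?_⟩
  filter_upwards [hγev, hσev, hTev, hWev, hη0, hτeq, hs1, hAη, hrate, ht.eventually_ge_atTop T₁',
    ht.eventually_ge_atTop Ta, ht.eventually_gt_atTop x₁, ht.eventually ha,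
    hMη (1 / 2) (by norm_num) M, hMη 1 one_pos M₁, hMη 1 one_pos (2 * Ca * l)]
    with n hγn hσn hTn hWn hηn hτn hsn hAn hraten htT₁ htTa htx₁ hat hMn hM₁n hCan
  set a₀ := t n ^ γ * Real.exp (L (t n)) with ha₀
  have htn0 : 0 < t n := by linarith [hrep.one_lt]
  have ha₀0 : 0 < a₀ := by positivity
  have hwn := w_nonneg γ hsn
  have hscn : |a (t n) / a₀ - 1| ≤ 2 * Ca * l * η n := by
    calc |a (t n) / a₀ - 1| ≤ Ca * |A (t n)| := hscale _ htTa
      _ ≤ Ca * (2 * l * η n) := by gcongr; exact hAn.2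
      _ = _ := by ring
  have hgood : ∀ ω, |γhat n ω - γ| ≤ M₁ * η n → |σhat n ω / a (t n) - 1| ≤ M₂ * η n →
      |(orderStat n (fun i => X i ω) (n - k n) - tailQuantile (cdf μ) (t n)) / a₀| ≤ M₃ * η n →
      hellinger (predictiveDensity μ (quantile (cdf μ) (τE n)))
          (gpPredictiveDensity (γhat n ω) (σhat n ω) (τ n)
            (orderStat n (fun i => X i ω) (n - k n))) ≤
        Real.sqrt (200 * Γ * (4 * M * N * C₂)) * Real.sqrt (ε n * w γ (1 / τ n)) := by
    intro ω h1 h2 h3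
    have hle : ∀ M' : ℝ, M' ≤ M → M' * η n ≤ M * η n := fun M' hM' => by gcongr
    have hσ : |σhat n ω / a₀ - 1| ≤ M * η n := by
      have h4 : σhat n ω / a₀ - 1
          = (σhat n ω / a (t n) - 1) * (a (t n) / a₀) + (a (t n) / a₀ - 1) := by
        field_simp
        ring
      have h5 : |a (t n) / a₀| ≤ 2 := by
        have := abs_le.1 (hscn.trans hCan)
        rw [abs_le]; constructor <;> linarith
      rw [h4]
      calc _ ≤ |σhat n ω / a (t n) - 1| * |a (t n) / a₀| + |a (t n) / a₀ - 1| := by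
            rw [← abs_mul]; exact abs_add_le _ _
        _ ≤ (M₂ * η n) * 2 + 2 * Ca * l * η n := by gcongr
        _ = (2 * M₂ + 2 * Ca * l) * η n := by ring
        _ ≤ M * η n := hle _ (by
          have : 0 < C₁ * l := by positivity
          linarith)
    have hAt : ∀ x, 1 ≤ x → |A (t n * x)| ≤ M * η n * x ^ δ := by
      intro x hx
      have hx0 : 0 < x := by linarith
      calc |A (t n * x)| ≤ C₁ * x ^ δ * |A (t n)| := hgrow _ htT₁ x hx
        _ ≤ C₁ * x ^ δ * (2 * l * η n) := by gcongr; exact hAn.2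
        _ = (2 * C₁ * l * η n) * x ^ δ := by ring
        _ ≤ M * η n * x ^ δ := by
          gcongr
          have : 0 < Ca * l := by positivity
          linarith
    have hbΓ : |γhat n ω| ≤ Γ := by
      have h4 := abs_sub_abs_le_abs_sub (γhat n ω) γ
      linarith
    have hpos : 0 < Ca * l := by positivity
    have hpos2 : 0 < C₁ * l := by positivity
    have hmain := hellinger_predictiveDensity_le hrep htx₁ hsn hδ0 (mul_pos hM hηn) hMn
      (h1.trans (hle _ (by linarith))) hσ (h3.trans (hle _ (by linarith))) hAt hΓ1 hbΓ
      (by positivity) (hWn _ h1)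
    rw [one_div_one_div] at hmain
    have htail : quantile (cdf μ) (τE n) = tailQuantile (cdf μ) (t n * (1 / τ n)) := by
      rw [tailQuantile, hτn.2.2.2]
    rw [htail]
    refine hmain.trans ?_
    rw [← Real.sqrt_mul (by positivity)]
    apply Real.sqrt_le_sqrt
    calc 200 * Γ * (4 * (M * η n) * (N * (1 + w γ (1 / τ n))))
        = 200 * Γ * (4 * M * N) * (η n * (1 + w γ (1 / τ n))) := by ring
      _ ≤ 200 * Γ * (4 * M * N) * (C₂ * (ε n * w γ (1 / τ n))) := by gcongr
      _ = _ := by ring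
  have hsub : {ω | Real.sqrt (200 * Γ * (4 * M * N * C₂)) * Real.sqrt (ε n * w γ (1 / τ n)) <
      |hellinger (predictiveDensity μ (quantile (cdf μ) (τE n)))
          (gpPredictiveDensity (γhat n ω) (σhat n ω) (τ n)
            (orderStat n (fun i => X i ω) (n - k n)))|} ⊆
      {ω | M₁ * η n < |(|γhat n ω - γ|)|} ∪ {ω | M₂ * η n < |(|σhat n ω / a (t n) - 1|)|} ∪
      {ω | M₃ * η n < |(orderStat n (fun i => X i ω) (n - k n)
        - tailQuantile (cdf μ) (t n)) / a₀|} := by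
    intro ω hω
    by_contra hcon
    simp only [Set.mem_union, Set.mem_ofPred_eq, not_or, not_lt, abs_abs] at hcon hω
    have h1 := hgood ω hcon.1.1 hcon.1.2 hcon.2
    rw [abs_of_nonneg (by unfold hellinger; positivity)] at hω
    exact absurd h1 (not_le.2 hω)
  calc P _ ≤ _ := measure_mono hsub
    _ ≤ _ := (measure_union_le _ _).trans (add_le_add_left (measure_union_le _ _) _)
    _ ≤ ENNReal.ofReal (δ' / 3) + ENNReal.ofReal (δ' / 3) + ENNReal.ofReal (δ' / 3) := by
      gcongr
    _ = ENNReal.ofReal δ' := by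
      rw [← ENNReal.ofReal_add hδ3.le hδ3.le, ← ENNReal.ofReal_add (by positivity) hδ3.le]
      congr 1; ring
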